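/- **Model.** Let $d\ge 2$, $\lambda>0$, and let $\pi=(\pi_1,\pi_2)$ be a probability vector. For $i,j\in\{1,2\}$ let $P_{ij}$ be probability laws on $\mathbb R$ with densities $p_{ij}$ with respect to a common $\sigma$-finite measure $m$ (Lebesgue measure, or counting measure on a countable set in the discrete case), with $P_{12}=P_{21}$, $P_{11}\ne P_{12}$ and $P_{21}=P_{22}$. For $n\in\mathbb N$, let $G\sim\mathrm{GHCM}(\lambda,n,\pi,P,d)$: the vertex set $V$ is a homogeneous Poisson point process of intensity $\lambda$ in $\mathcal S_{d,n}=[-n^{1/d}/2,n^{1/d}/2]^d$ with the toroidal metric $\|u-v\|^2=\sum_{l=1}^d\min\{|u_l-v_l|,\,n^{1/d}-|u_l-v_l|\}^2$; every vertex $u$ independently receives a community $x^\star(u)\in\{1,2\}$ with law $\pi$; given this, the observations $Y_{uv}$ on pairs are independent, with $Y_{uv}\sim P_{x^\star(u)x^\star(v)}$ if $\|u-v\|\le(\log n)^{1/d}$ and $Y_{uv}=0$ otherwise. Put $C^\star=\{u\in V: x^\star(u)=1\}$. Let $\nu_d$ be the volume of the Euclidean unit ball of $\mathbb R^d$, $\theta_i=(p_{i1},p_{i2})$,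 and $$D_+(\theta_i,\theta_j)=1-\inf_{t\in[0,1]}\sum_{l=1}^{2}\pi_l\int p_{il}^{\,t}\,p_{jl}^{\,1-t}\,dm .$$ **Visibility graph.** For $\chi,\delta>0$ cut $\mathcal S_{d,n}$ into $m_n^d$ congruent cubes (blocks) of side $n^{1/d}/m_n$, where $m_n=\lceil (n/(\chi\log n))^{1/d}\rceil$; thus the blocks have volume $\chi\log n$ up to the rounding that makes their number an integer. The *$C^\star$-visibility graph* has as vertices the blocks that contain at least $\delta\log n$ vertices of $C^\star$, and two distinct such blocks $B,B'$ are adjacent if $\|x-y\|\le(\log n)^{1/d}$ for all $x\in B$, $y\in B'$. **Proposition.** Let $d\ge2$, $\lambda'>0$, and let $\chi$ satisfy $$1-\tfrac{3\sqrt d\,\chi^{1/d}}{2}>0,\qquad \nu_d\Big(1-\tfrac{3\sqrt d\,\chi^{1/d}}{2}\Big)^d\ \ge\ \tfrac12\Big(\nu_d+\tfrac1{\lambda'}\Big),\qquad 0<\chi<\tfrac12\Big(\nu_d-\tfrac1{\lambda'}\Big).$$ Then there is a constant $\widetilde\delta>0$, depending only on $d,\lambda',\chi$, such that the following holds for every model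 as above with $\pi_1\lambda=\lambda'$ and $$\lambda\,\nu_d\,\min_{i\ne j}D_+(\theta_i,\theta_j)>1 .$$ For every $\delta$ with $0<\delta<\widetilde\delta\chi/(\nu_dR_d)$, where $R_d=1-\sqrt d\,\chi^{1/d}/2$, the probability that the $C^\star$-visibility graph is connected tends to $1$ as $n\to\infty$. -/

import Mathlib

open MeasureTheory ProbabilityTheory Filter Topology
open scoped NNReal ENNReal

noncomputable section

/-! ## The torus and its blocks -/

/-- The side length `n^{1/d}` of the region `[-n^{1/d}/2, n^{1/d}/2]^d`. -/
def sideLength (d n : ℕ) : ℝ := (n : ℝ) ^ (1 / (d : ℝ))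

/-- The region `[-n^{1/d}/2, n^{1/d}/2]^d`, of volume `n`. -/
def region (d n : ℕ) : Set (Fin d → ℝ) :=
  Set.Icc (fun _ => -(sideLength d n) / 2) (fun _ => sideLength d n / 2)

/-- The toroidal metric on the region. -/
def torusDist (d n : ℕ) (u v : Fin d → ℝ) : ℝ :=
  Real.sqrt (∑ l, (min |u l - v l| (sideLength d n - |u l - v l|)) ^ 2)

/-- The visibility radius `(log n)^{1/d}`. -/
def visRadius (d n : ℕ) : ℝ := (Real.log n) ^ (1 / (d : ℝ))

/-- The volume of the Euclidean unit ball of `ℝ^d`. -/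
def unitBallVolume (d : ℕ) : ℝ :=
  (volume (Metric.ball (0 : EuclideanSpace ℝ (Fin d)) 1)).toReal

/-- The number of blocks along each axis: `(n / (χ log n))^{1/d}`, rounded up to an integer. -/
def blocksPerSide (d n : ℕ) (χ : ℝ) : ℕ :=
  ⌈((n : ℝ) / (χ * Real.log n)) ^ (1 / (d : ℝ))⌉₊

/-- The blocks: the region is cut into `m^d` congruent cubes of side `n^{1/d} / m`, with
`m = blocksPerSide d n χ`. The cubes are half-open, since opposite faces of the region are
identified. -/
def block (d n : ℕ) (χ : ℝ) (i : Fin d → Fin (blocksPerSide d n χ)) : Set (Fin d → ℝ) :=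
  {x | ∀ l,
    -(sideLength d n) / 2 + (i l : ℝ) * (sideLength d n / blocksPerSide d n χ) ≤ x l ∧
    x l < -(sideLength d n) / 2 + ((i l : ℝ) + 1) * (sideLength d n / blocksPerSide d n χ)}

/-- Two sets are mutually visible if all their points are within the visibility radius. -/
def MutuallyVisible (d n : ℕ) (A B : Set (Fin d → ℝ)) : Prop :=
  ∀ x ∈ A, ∀ y ∈ B, torusDist d n x y ≤ visRadius d n

theorem torusDist_comm (d n : ℕ) (u v : Fin d → ℝ) : torusDist d n u v = torusDist d n v u := by
  simp only [torusDist, abs_sub_comm]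

theorem MutuallyVisible.symm {d n : ℕ} {A B : Set (Fin d → ℝ)} (h : MutuallyVisible d n A B) :
    MutuallyVisible d n B A := fun x hx y hy => by
  rw [torusDist_comm]
  exact h y hy x hx

/-- The `(χ, δ)`-visibility graph of a point configuration in the region, where `cnt A` is the
number of points of the configuration in `A`: its vertices are the blocks with at least
`δ log n` points, and edges join distinct mutually visible blocks. -/
def visibilityGraph (d n : ℕ) (χ δ : ℝ) (cnt : Set (Fin d → ℝ) → ℕ) :
    SimpleGraph {i : Fin d → Fin (blocksPerSide d n χ) //
      δ * Real.log n ≤ (cnt (block d n χ i) : ℝ)} where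
  Adj i j := i ≠ j ∧ MutuallyVisible d n (block d n χ i.1) (block d n χ j.1)
  symm := ⟨fun _ _ h => ⟨h.1.symm, h.2.symm⟩⟩
  loopless := ⟨fun _ h => h.1 rfl⟩

/-! ## Poisson point processes -/

open Classical in
/-- The number of the points `X 0 ω, …, X (N ω - 1) ω` that lie in `A`. -/
def pointCount {Ω E : Type*} (N : Ω → ℕ) (X : ℕ → Ω → E) (A : Set E) (ω : Ω) : ℕ :=
  ((Finset.range (N ω)).filter (fun k => X k ω ∈ A)).card

/-- The random points `X 0, …, X (N - 1)` form a Poisson point process whose intensity measure is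
the finite measure `Λ`: the number of points in a measurable set `A` has the Poisson law of mean
`Λ A`, and the numbers of points in disjoint measurable sets are independent. -/
structure IsPoissonProcess {Ω E : Type*} [MeasurableSpace Ω] [MeasurableSpace E]
    (μ : Measure Ω) (Λ : Measure E) (N : Ω → ℕ) (X : ℕ → Ω → E) : Prop where
  finite : Λ Set.univ ≠ ∞
  measurable_number : Measurable N
  measurable_point : ∀ k, Measurable (X k)
  count_law : ∀ A : Set E, MeasurableSet A →
    μ.map (pointCount N X A) = poissonMeasure (Λ A).toNNReal
  count_indep : ∀ (r : ℕ) (A : Fin r → Set E), (∀ j, MeasurableSet (A j)) →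
    Pairwise (fun i j => Disjoint (A i) (A j)) →
    iIndepFun (fun j => pointCount N X (A j)) μ

/-! ## The geometric hidden community model -/

/-- The parameters `λ`, `π`, `P` of the model with communities `Fin k`. The observation law
`P i j` is given by its density `dens i j` with respect to a common σ-finite measure `ref`
(Lebesgue measure for densities, counting measure on a countable set for mass functions). -/
structure GHCMParams (k : ℕ) where
  lam : ℝ
  lam_pos : 0 < lam
  prior : Fin k → ℝ
  prior_nonneg : ∀ i, 0 ≤ prior i
  prior_sum : ∑ i, prior i = 1
  ref : Measure ℝ
  ref_sigmaFinite : SigmaFinite ref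
  dens : Fin k → Fin k → ℝ → ℝ
  dens_measurable : ∀ i j, Measurable (dens i j)
  dens_nonneg : ∀ i j y, 0 ≤ dens i j y
  dens_lintegral : ∀ i j, ∫⁻ y, ENNReal.ofReal (dens i j y) ∂ref = 1
  dens_symm : ∀ i j, dens i j =ᵐ[ref] dens j i

/-- The observation law `P i j`. -/
def GHCMParams.obsLaw {k : ℕ} (θ : GHCMParams k) (i j : Fin k) : Measure ℝ :=
  θ.ref.withDensity (fun y => ENNReal.ofReal (θ.dens i j y))

/-- The Chernoff–Hellinger divergence `D₊(p, q)` of two vectors of densities with respect to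
`ref`, with weights `w`. -/
def chDivergence {k : ℕ} (ref : Measure ℝ) (w : Fin k → ℝ) (p q : Fin k → ℝ → ℝ) : ℝ :=
  1 - ⨅ t : Set.Icc (0 : ℝ) 1,
    ∑ i, w i * ∫ y, (p i y) ^ (t : ℝ) * (q i y) ^ (1 - (t : ℝ)) ∂ref

/-- `min_{i ≠ j} D₊(θ_i, θ_j)` with `θ_i = (p_{i1}, …, p_{ik})`. -/
def GHCMParams.minDivergence {k : ℕ} (θ : GHCMParams k) : ℝ :=
  ⨅ ij : {ij : Fin k × Fin k // ij.1 ≠ ij.2},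
    chDivergence θ.ref θ.prior (θ.dens ij.1.1) (θ.dens ij.1.2)

/-- A random labelled graph: the vertices are the indices `0, …, number - 1`; vertex `u` has the
location `loc u` and the community `label u`, and `obs u v` is the observation on the pair `u, v`.
The entries at indices that are not vertices are irrelevant. -/
structure GraphSample (Ω : Type*) (d k : ℕ) where
  number : Ω → ℕ
  loc : ℕ → Ω → (Fin d → ℝ)
  label : ℕ → Ω → Fin k
  obs : ℕ → ℕ → Ω → ℝ

/-- Locations and labels together. -/
def GraphSample.config {Ω : Type*} {d k : ℕ} (G : GraphSample Ω d k) (ω : Ω) :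
    ℕ × (ℕ → (Fin d → ℝ)) × (ℕ → Fin k) :=
  (G.number ω, (fun u => G.loc u ω), (fun u => G.label u ω))

open Classical in
/-- The law of the observation on a pair of vertices, given their locations and labels. -/
def GHCMParams.pairLaw {k : ℕ} (θ : GHCMParams k) (d n : ℕ)
    (x y : Fin d → ℝ) (i j : Fin k) : Measure ℝ :=
  if torusDist d n x y ≤ visRadius d n then θ.obsLaw i j else Measure.dirac 0

/-- `G` is sampled from `GHCM(λ, n, π, P, d)`. -/
structure IsGHCM {Ω : Type*} [MeasurableSpace Ω] {k : ℕ} (μ : Measure Ω) (θ : GHCMParams k)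
    (d n : ℕ) (G : GraphSample Ω d k) : Prop where
  /-- The locations are a Poisson process of intensity `λ` in the region. -/
  loc_poisson : IsPoissonProcess μ
    (ENNReal.ofReal θ.lam • (volume : Measure (Fin d → ℝ)).restrict (region d n)) G.number G.loc
  /-- The labels are independent, with law `π`, and independent of the locations. -/
  label_measurable : ∀ u, Measurable (G.label u)
  label_law : ∀ u i, μ {ω | G.label u ω = i} = ENNReal.ofReal (θ.prior i)
  label_iIndep : iIndepFun G.label μ
  label_indep_loc : IndepFun (fun ω u => G.label u ω)
    (fun ω => (G.number ω, fun u => G.loc u ω)) μ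
  /-- Given locations and labels, the observations on the pairs of vertices are independent and
  have the laws `pairLaw`. -/
  obs_measurable : ∀ u v, Measurable (G.obs u v)
  obs_symm : ∀ u v ω, G.obs u v ω = G.obs v u ω
  obs_law : ∀ F : Finset (ℕ × ℕ), (∀ p ∈ F, p.1 < p.2) →
    ∀ B : ℕ × ℕ → Set ℝ, (∀ p, MeasurableSet (B p)) →
    ∀ S : Set (ℕ × (ℕ → (Fin d → ℝ)) × (ℕ → Fin k)), MeasurableSet S →
      (∀ c ∈ S, ∀ p ∈ F, p.2 < c.1) →
    μ {ω | G.config ω ∈ S ∧ ∀ p ∈ F, G.obs p.1 p.2 ω ∈ B p} =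
      ∫⁻ ω in {ω | G.config ω ∈ S},
        ∏ p ∈ F, θ.pairLaw d n (G.loc p.1 ω) (G.loc p.2 ω) (G.label p.1 ω) (G.label p.2 ω) (B p) ∂μ

open Classical in
/-- The number of vertices of community `i` located in `A`. -/
def GraphSample.communityCount {Ω : Type*} {d k : ℕ} (G : GraphSample Ω d k) (i : Fin k) (ω : Ω)
    (A : Set (Fin d → ℝ)) : ℕ :=
  ((Finset.range (G.number ω)).filter (fun u => G.label u ω = i ∧ G.loc u ω ∈ A)).card

/-- The visibility graph formed by the vertices of `C⋆`, the community `1` of a two-community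
model, which is `0 : Fin 2` here. -/
def GraphSample.cstarVisibilityGraph {Ω : Type*} {d : ℕ} (G : GraphSample Ω d 2) (n : ℕ)
    (χ δ : ℝ) (ω : Ω) :=
  visibilityGraph d n χ δ (G.communityCount 0 ω)

/-- The conditions on `χ`, for the rate `r` (`λ'`). The base of the power in `volume_cond` is the
radius of a ball, hence positive. -/
structure ChiCondition (d : ℕ) (r χ : ℝ) : Prop where
  pos : 0 < χ
  radius_pos : 0 < 1 - 3 * Real.sqrt d * χ ^ (1 / (d : ℝ)) / 2
  volume_cond : (unitBallVolume d + 1 / r) / 2 ≤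
    unitBallVolume d * (1 - 3 * Real.sqrt d * χ ^ (1 / (d : ℝ)) / 2) ^ d
  lt : χ < (unitBallVolume d - 1 / r) / 2

/-- The constant `R_d`. -/
def radiusConst (d : ℕ) (χ : ℝ) : ℝ := 1 - Real.sqrt d * χ ^ (1 / (d : ℝ)) / 2

end

/-!
Write `c = χ ^ (1 / d)` and let `T` be the set of block displacements that force mutual visibility.
The unit cubes centred at the points of `T` cover the ball of radius `(1 - 3 √d c / 2) / c`, so the
conditions on `χ` give `r χ (#T - 1) > 1`.

If every window of a fixed radius contains fewer than `#T - 1` vacant blocks, the visibility graph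
is connected. Every window then has a fully occupied hyperplane slab in each direction, and all
these slabs lie in one component. A component that meets no slab is trapped between slabs, because
a step over a slab can be shortened to land in it. Such a component `C` is finite, and by
Cauchy–Davenport `C + T` has at least `#T - 1` sites outside `C`, all of them vacant and in the
same window.

By thinning, the community count in a union of `#T - 1` blocks is Poisson with mean about
`r χ (#T - 1) log n`, so for small `δ` a Chernoff bound makes all of these blocks vacant with
probability at most `n ^ (-a)` for some `a > 1`, against only `O(n)` choices of the blocks.
-/

/-! ### Connectivity of lattice configurations with few vacant sites -/

noncomputable section Lattice

open scoped Pointwise Finset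

variable {ι : Type*} [DecidableEq ι]

theorem rel_of_rel_add_single [Finite ι] {r : (ι → ℤ) → (ι → ℤ) → Prop} (hr : Equivalence r)
    (h : ∀ x l, r x (x + Pi.single l 1)) (x y : ι → ℤ) : r x y := by
  have := Fintype.ofFinite ι
  let H : AddSubgroup (ι → ℤ) :=
    { carrier := {v | ∀ x, r x (x + v)}
      zero_mem' := fun x => by simpa using hr.refl x
      add_mem' := fun hv hw x => by simpa [add_assoc] using hr.trans (hv x) (hw _)
      neg_mem' := fun {v} hv x => by simpa using hr.symm (hv (x + -v)) }
  have hmem : ∑ l, Pi.single l ((y - x) l) ∈ H := sum_mem fun l _ => by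
    rw [← mul_one ((y - x) l), ← smul_eq_mul, Pi.single_smul]
    exact H.zsmul_mem (h · l) _
  rw [Finset.univ_sum_single] at hmem
  simpa using hmem x

/-- A set of lattice steps that contains the positive unit steps and, with every step, all steps
along a single axis that are no longer than its component along that axis. -/
structure IsStepSet (T : Finset (ι → ℤ)) : Prop where
  unit_mem : ∀ l, Pi.single l 1 ∈ T
  single_mem : ∀ k ∈ T, ∀ l a, |a| ≤ |k l| → Pi.single l a ∈ T

/-- The graph on the lattice that joins two occupied sites whenever they differ by a step in `T`.
Vacant sites are isolated vertices. -/
def stepGraph (T : Finset (ι → ℤ)) (occ : Set (ι → ℤ)) : SimpleGraph (ι → ℤ) :=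
  SimpleGraph.fromRel fun x y => x ∈ occ ∧ y ∈ occ ∧ y - x ∈ T

variable {T : Finset (ι → ℤ)} {occ : Set (ι → ℤ)}

omit [DecidableEq ι] in
theorem stepGraph_reachable_of_sub_mem {x y : ι → ℤ} (hx : x ∈ occ) (hy : y ∈ occ)
    (h : y - x ∈ T) : (stepGraph T occ).Reachable x y := by
  rcases eq_or_ne x y with rfl | hne
  · rfl
  · exact SimpleGraph.Adj.reachable ⟨hne, .inl ⟨hx, hy, h⟩⟩

omit [DecidableEq ι] in
theorem stepGraph_adj_mem_right {x y : ι → ℤ} (h : (stepGraph T occ).Adj x y) : y ∈ occ := by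
  obtain ⟨-, h | h⟩ := h
  exacts [h.2.1, h.1]

omit [DecidableEq ι] in
theorem mem_of_stepGraph_reachable {x y : ι → ℤ} (hx : x ∈ occ)
    (h : (stepGraph T occ).Reachable x y) : y ∈ occ := by
  rw [SimpleGraph.reachable_iff_reflTransGen] at h
  cases h with
  | refl => exact hx
  | tail _ hadj => exact stepGraph_adj_mem_right hadj

theorem IsStepSet.single_mem_of_adj (hT : IsStepSet T) {x y : ι → ℤ}
    (h : (stepGraph T occ).Adj x y) {l : ι} {a : ℤ} (ha : |a| ≤ |y l - x l|) :
    Pi.single l a ∈ T := by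
  obtain ⟨-, ⟨-, -, h⟩ | ⟨-, -, h⟩⟩ := h
  · exact hT.single_mem _ h l a ha
  · exact hT.single_mem _ h l a (by rwa [Pi.sub_apply, abs_sub_comm])

theorem stepGraph_reachable_of_Icc_subset [Finite ι] (hT : IsStepSet T) {a b : ι → ℤ}
    (hocc : Set.Icc a b ⊆ occ) {x y : ι → ℤ} (hx : x ∈ Set.Icc a b) (hy : y ∈ Set.Icc a b) :
    (stepGraph T occ).Reachable x y := by
  have hab : a ≤ b := hx.1.trans hx.2
  -- Clamping to the box turns a walk of unit steps into a walk inside the box.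
  let clamp (x : ι → ℤ) : ι → ℤ := a ⊔ (b ⊓ x)
  have clamp_mem (x) : clamp x ∈ occ := hocc ⟨le_sup_left, sup_le hab inf_le_left⟩
  have clamp_eq {x} (hx : x ∈ Set.Icc a b) : clamp x = x := by
    simp only [clamp, inf_eq_right.2 hx.2, sup_eq_right.2 hx.1]
  rw [← clamp_eq hx, ← clamp_eq hy]
  refine rel_of_rel_add_single
    (SimpleGraph.reachable_is_equivalence (stepGraph T occ) |>.comap clamp) (fun x l => ?_) x y
  obtain h | h : clamp (x + Pi.single l 1) = clamp x ∨
      clamp (x + Pi.single l 1) - clamp x = Pi.single l 1 := by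
    have hl := hab l
    by_cases h : a l ≤ x l ∧ x l < b l
    · right
      ext j
      rcases eq_or_ne j l with rfl | hj
      · simp [clamp]; omega
      · simp [clamp, hj]
    · left
      ext j
      rcases eq_or_ne j l with rfl | hj
      · simp [clamp]; omega
      · simp [clamp, hj]
  · rw [Function.onFun, h]
  · refine stepGraph_reachable_of_sub_mem (clamp_mem _) (clamp_mem _) ?_
    rw [h]
    exact hT.unit_mem l

variable [Fintype ι]

/-- The cube of lattice sites at sup-distance at most `L` from `z`. -/
def window (z : ι → ℤ) (L : ℕ) : Finset (ι → ℤ) :=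
  Finset.Icc (fun l => z l - L) (fun l => z l + L)

theorem mem_window {z y : ι → ℤ} {L : ℕ} : y ∈ window z L ↔ ∀ l, z l - L ≤ y l ∧ y l ≤ z l + L := by
  simp [window, Pi.le_def, forall_and]

theorem update_mem_window {z x : ι → ℤ} {L : ℕ} (hx : x ∈ window z L) {l : ι} {a : ℤ}
    (ha : a ∈ Finset.Icc (z l - L) (z l + L)) : Function.update x l a ∈ window z L := by
  rw [mem_window] at hx ⊢
  exact fun j => by rcases eq_or_ne j l with rfl | hj <;> simp_all

open Classical in
/-- The vacant sites in the window of radius `L` around `z`. -/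
def vacantSites (occ : Set (ι → ℤ)) (L : ℕ) (z : ι → ℤ) : Finset (ι → ℤ) :=
  (window z L).filter (· ∉ occ)

theorem mem_vacantSites {L : ℕ} {z y : ι → ℤ} :
    y ∈ vacantSites occ L z ↔ y ∈ window z L ∧ y ∉ occ := by
  simp only [vacantSites, Finset.mem_filter]

/-- The site `x` lies in the window around `z`, and all sites of this window in the hyperplane
through `x` orthogonal to the axis `l` are occupied. -/
def OnFullSlab (occ : Set (ι → ℤ)) (L : ℕ) (z x : ι → ℤ) (l : ι) : Prop :=
  x ∈ window z L ∧ ∀ y ∈ window z L, y l = x l → y ∈ occ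

variable {L : ℕ} {z x y : ι → ℤ}

theorem onFullSlab_update (hx : x ∈ window z L) {l : ι} {a : ℤ}
    (ha : a ∈ Finset.Icc (z l - L) (z l + L)) (hfull : ∀ v ∈ vacantSites occ L z, v l ≠ a) :
    OnFullSlab occ L z (Function.update x l a) l := by
  refine ⟨update_mem_window hx ha, fun y hy hyl => by_contra fun hocc => ?_⟩
  exact hfull y (mem_vacantSites.2 ⟨hy, hocc⟩) (by simpa using hyl)

omit [DecidableEq ι] [Fintype ι] in
theorem exists_mem_forall_apply_ne (V : Finset (ι → ℤ)) (I : Finset ℤ) (l : ι) (h : #V < #I) :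
    ∃ a ∈ I, ∀ v ∈ V, v l ≠ a := by
  obtain ⟨a, ha, haV⟩ := Finset.exists_mem_notMem_of_card_lt_card
    ((Finset.card_image_le (s := V) (f := (· l))).trans_lt h)
  exact ⟨a, ha, fun v hv hva => haV (Finset.mem_image.2 ⟨v, hv, hva⟩)⟩

theorem OnFullSlab.reachable_of_apply_eq (hT : IsStepSet T) {l : ι} (hx : OnFullSlab occ L z x l)
    (hy : y ∈ window z L) (hxy : y l = x l) : (stepGraph T occ).Reachable x y := by
  obtain ⟨hxw, hocc⟩ := hx
  have hIcc (p : ι → ℤ) : p ∈ Set.Icc (Function.update (fun j => z j - L) l (x l))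
      (Function.update (fun j => z j + L) l (x l)) ↔ p ∈ window z L ∧ p l = x l := by
    simp only [Set.mem_Icc, update_le_iff, le_update_iff, mem_window]
    rw [mem_window] at hxw
    have := hxw l
    constructor
    · rintro ⟨⟨h1, h2⟩, h3, h4⟩
      refine ⟨fun j => ?_, le_antisymm h3 h1⟩
      rcases eq_or_ne j l with rfl | hj
      · omega
      · exact ⟨h2 j hj, h4 j hj⟩
    · exact fun ⟨h, hl⟩ => ⟨⟨hl.ge, fun j _ => (h j).1⟩, hl.le, fun j _ => (h j).2⟩
  exact stepGraph_reachable_of_Icc_subset hT (fun p hp => ((hIcc p).1 hp).elim (hocc p))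
    ((hIcc x).2 ⟨hxw, rfl⟩) ((hIcc y).2 ⟨hy, hxy⟩)

theorem OnFullSlab.reachable_of_ne (hT : IsStepSet T) {l l' : ι} (hx : OnFullSlab occ L z x l)
    (hy : OnFullSlab occ L z y l') (hl : l ≠ l') : (stepGraph T occ).Reachable x y := by
  have hcorner : Function.update x l' (y l') ∈ window z L :=
    update_mem_window hx.1 (Finset.mem_Icc.2 (mem_window.1 hy.1 l'))
  exact (hx.reachable_of_apply_eq hT hcorner (by simp [hl])).trans
    (hy.reachable_of_apply_eq hT hcorner (by simp)).symm

theorem OnFullSlab.reachable [Nontrivial ι] (hT : IsStepSet T) (hV : #(vacantSites occ L z) < L)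
    {l l' : ι} (hx : OnFullSlab occ L z x l) (hy : OnFullSlab occ L z y l') :
    (stepGraph T occ).Reachable x y := by
  rcases eq_or_ne l l' with rfl | hl
  · obtain ⟨j, hj⟩ := exists_ne l
    obtain ⟨a, ha, hfull⟩ := exists_mem_forall_apply_ne (vacantSites occ L z)
      (Finset.Icc (z j - L) (z j + L)) j (by rw [Int.card_Icc]; omega)
    have hp := onFullSlab_update hx.1 ha hfull
    exact (hx.reachable_of_ne hT hp hj.symm).trans (hp.reachable_of_ne hT hy hj)
  · exact hx.reachable_of_ne hT hy hl

theorem exists_onFullSlab_add_single [Nontrivial ι] (hV : ∀ z, #(vacantSites occ L z) < L)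
    (z : ι → ℤ) (l : ι) :
    ∃ p j, OnFullSlab occ L z p j ∧ OnFullSlab occ L (z + Pi.single l 1) p j := by
  obtain ⟨j, hj⟩ := exists_ne l
  set z' := z + Pi.single l 1
  have hz'j : z' j = z j := by simp [z', hj]
  have hV1 := hV z
  have hV2 := hV z'
  obtain ⟨a, ha, hfull⟩ := exists_mem_forall_apply_ne (vacantSites occ L z ∪ vacantSites occ L z')
    (Finset.Icc (z j - L) (z j + L)) j
    ((Finset.card_union_le _ _).trans_lt (by rw [Int.card_Icc]; omega))
  have hz : z ∈ window z L := mem_window.2 fun i => by omega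
  have hz' : z ∈ window z' L := mem_window.2 fun i => by
    have : 0 ≤ (Pi.single l 1 : ι → ℤ) i ∧ (Pi.single l 1 : ι → ℤ) i ≤ 1 := by
      rcases eq_or_ne i l with rfl | hi <;> simp_all
    simp only [z', Pi.add_apply]
    omega
  exact ⟨Function.update z j a, j,
    onFullSlab_update hz ha fun v hv => hfull v (Finset.mem_union_left _ hv),
    onFullSlab_update hz' (hz'j ▸ ha) fun v hv => hfull v (Finset.mem_union_right _ hv)⟩

theorem OnFullSlab.reachable_of_windows [Nontrivial ι] (hT : IsStepSet T)
    (hV : ∀ z, #(vacantSites occ L z) < L) {z' : ι → ℤ} {l l' : ι}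
    (hx : OnFullSlab occ L z x l) (hy : OnFullSlab occ L z' y l') :
    (stepGraph T occ).Reachable x y := by
  let r (z z' : ι → ℤ) : Prop := ∀ x y l l', OnFullSlab occ L z x l → OnFullSlab occ L z' y l' →
    (stepGraph T occ).Reachable x y
  have hr : Equivalence r :=
    { refl := fun z x y l l' hx hy => hx.reachable hT (hV z) hy
      symm := fun h x y l l' hx hy => (h y x l' l hy hx).symm
      trans := fun {_ z _} h h' x y l l' hx hy => by
        obtain ⟨p, j, hp, -⟩ := exists_onFullSlab_add_single hV z l
        exact (h x p l j hx hp).trans (h' p y j l' hp hy) }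
  refine rel_of_rel_add_single hr (fun z i x y l l' hx hy => ?_) z z' x y l l' hx hy
  obtain ⟨p, j, hp, hp'⟩ := exists_onFullSlab_add_single hV z i
  exact (hx.reachable hT (hV z) hp).trans (hp'.reachable hT (hV _) hy)

theorem exists_onFullSlab_of_crossing (hT : IsStepSet T) (hadj : (stepGraph T occ).Adj x y)
    (hxocc : x ∈ occ) (hx : x ∈ window z L) {l : ι} {a : ℤ}
    (ha : a ∈ Finset.Icc (z l - L) (z l + L)) (hfull : ∀ v ∈ vacantSites occ L z, v l ≠ a)
    (hcross : |a - x l| ≤ |y l - x l|) :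
    ∃ p, OnFullSlab occ L z p l ∧ (stepGraph T occ).Reachable x p := by
  have hp := onFullSlab_update hx ha hfull
  refine ⟨_, hp, stepGraph_reachable_of_sub_mem hxocc (hp.2 _ hp.1 rfl) ?_⟩
  have hsub : Function.update x l a - x = Pi.single l (a - x l) := by
    ext j
    rcases eq_or_ne j l with rfl | hj <;> simp [*]
  exact hsub ▸ hT.single_mem_of_adj hadj hcross

theorem mem_Ioo_of_reachable_of_not_onFullSlab (hT : IsStepSet T) {lo hi : ι → ℤ}
    (hlo : lo ∈ window x L) (hhi : hi ∈ window x L)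
    (hlofull : ∀ l, ∀ v ∈ vacantSites occ L x, v l ≠ lo l)
    (hhifull : ∀ l, ∀ v ∈ vacantSites occ L x, v l ≠ hi l)
    (hx : x ∈ occ) (hlt : ∀ l, x l ∈ Finset.Ioo (lo l) (hi l))
    (hno : ∀ p l, OnFullSlab occ L x p l → ¬ (stepGraph T occ).Reachable x p)
    (hy : (stepGraph T occ).Reachable x y) (l : ι) : y l ∈ Finset.Ioo (lo l) (hi l) := by
  rw [mem_window] at hlo hhi
  rw [SimpleGraph.reachable_iff_reflTransGen] at hy
  induction hy generalizing l with
  | refl => exact hlt l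
  | @tail y y' hxy hadj ih =>
    rw [← SimpleGraph.reachable_iff_reflTransGen] at hxy
    simp only [Finset.mem_Ioo] at ih ⊢
    have hyw : y ∈ window x L := mem_window.2 fun j => by
      have := ih j; have := hlo j; have := hhi j; omega
    have hncross {a : ℤ} (ha : a ∈ Finset.Icc (x l - L) (x l + L))
        (hfull : ∀ v ∈ vacantSites occ L x, v l ≠ a) : |y' l - y l| < |a - y l| := by
      by_contra! hle
      obtain ⟨p, hp, hyp⟩ := exists_onFullSlab_of_crossing hT hadj
        (mem_of_stepGraph_reachable hx hxy) hyw ha hfull hle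
      exact hno p l hp (hxy.trans hyp)
    have h1 := hncross (Finset.mem_Icc.2 (hlo l)) (hlofull l)
    have h2 := hncross (Finset.mem_Icc.2 (hhi l)) (hhifull l)
    have := ih l
    grind

theorem card_sub_one_le_card_add_sdiff {A : Type*} [AddCommGroup A] [IsAddTorsionFree A]
    [DecidableEq A] {C T : Finset A} (hC : C.Nonempty) (hT : T.Nonempty) :
    #T - 1 ≤ #((C + T) \ C) := by
  have := cauchy_davenport_of_isAddTorsionFree hC hT
  have := Finset.le_card_sdiff C (C + T)
  omega

theorem card_sub_one_le_card_vacantSites {C : Finset (ι → ℤ)} (hT : T.Nonempty) (hx : x ∈ occ)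
    (hC : ∀ y, y ∈ C ↔ (stepGraph T occ).Reachable x y) (hCT : C + T ⊆ window z L) :
    #T - 1 ≤ #(vacantSites occ L z) := by
  refine (card_sub_one_le_card_add_sdiff ⟨x, (hC x).2 .rfl⟩ hT).trans
    (Finset.card_le_card fun y hy => ?_)
  obtain ⟨hyCT, hyC⟩ := Finset.mem_sdiff.1 hy
  obtain ⟨c, hc, k, hk, rfl⟩ := Finset.mem_add.1 hyCT
  rw [hC] at hc hyC
  exact mem_vacantSites.2 ⟨hCT hyCT, fun hocc => hyC (hc.trans
    (stepGraph_reachable_of_sub_mem (mem_of_stepGraph_reachable hx hc) hocc (by simpa)))⟩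

theorem exists_onFullSlab_reachable [Nonempty ι] (hT : IsStepSet T)
    (hL : ∀ k ∈ T, ∀ l, (#T : ℤ) + |k l| ≤ L) (hV : #(vacantSites occ L x) < #T - 1)
    (hx : x ∈ occ) : ∃ y l, OnFullSlab occ L x y l ∧ (stepGraph T occ).Reachable x y := by
  by_contra! hno
  have hTne : T.Nonempty := ⟨_, hT.unit_mem (Classical.arbitrary ι)⟩
  have exists_full (l : ι) (I : Finset ℤ) (hI : #I = #T) :
      ∃ a ∈ I, ∀ v ∈ vacantSites occ L x, v l ≠ a :=
    exists_mem_forall_apply_ne _ I l (by omega)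
  choose hi hhi hhifull using fun l =>
    exists_full l (Finset.Icc (x l + 1) (x l + #T)) (by rw [Int.card_Icc]; omega)
  choose lo hlo hlofull using fun l =>
    exists_full l (Finset.Icc (x l - #T) (x l - 1)) (by rw [Int.card_Icc]; omega)
  simp only [Finset.mem_Icc] at hhi hlo
  have hTL : (#T : ℤ) ≤ L := by
    obtain ⟨k, hk⟩ := hTne
    exact (le_add_of_nonneg_right (abs_nonneg _)).trans (hL k hk (Classical.arbitrary ι))
  have trapped (y) (hy : (stepGraph T occ).Reachable x y) (l) : lo l < y l ∧ y l < hi l :=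
    Finset.mem_Ioo.1 <| mem_Ioo_of_reachable_of_not_onFullSlab hT
      (mem_window.2 fun l => by have := hlo l; omega)
      (mem_window.2 fun l => by have := hhi l; omega) hlofull hhifull hx
      (fun l => Finset.mem_Ioo.2 (by have := hlo l; have := hhi l; omega)) (by simpa using hno) hy l
  have hfin : {y | (stepGraph T occ).Reachable x y}.Finite :=
    (Set.finite_Icc lo hi).subset fun y hy =>
      ⟨fun l => (trapped y hy l).1.le, fun l => (trapped y hy l).2.le⟩
  refine (card_sub_one_le_card_vacantSites hTne hx (C := hfin.toFinset) (by simp)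
    fun y hy => mem_window.2 fun j => ?_).not_gt hV
  obtain ⟨c, hc, k, hk, rfl⟩ := Finset.mem_add.1 hy
  have := trapped c (by simpa using hc) j
  have := hlo j
  have := hhi j
  have := hL k hk j
  have := abs_le.1 (le_refl |k j|)
  rw [Pi.add_apply]
  omega

theorem stepGraph_reachable_of_card_vacantSites_lt [Nontrivial ι] (hT : IsStepSet T)
    (hL : ∀ k ∈ T, ∀ l, (#T : ℤ) + |k l| ≤ L) (hV : ∀ z, #(vacantSites occ L z) < #T - 1)
    (hx : x ∈ occ) (hy : y ∈ occ) : (stepGraph T occ).Reachable x y := by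
  obtain ⟨p, l, hp, hxp⟩ := exists_onFullSlab_reachable hT hL (hV x) hx
  obtain ⟨q, l', hq, hyq⟩ := exists_onFullSlab_reachable hT hL (hV y) hy
  have hTL := (le_add_of_nonneg_right (abs_nonneg _)).trans (hL _ (hT.unit_mem l) l)
  have hV' (z) : #(vacantSites occ L z) < L := by have := hV z; omega
  exact hxp.trans ((hp.reachable_of_windows hT hV' hq).trans hyq.symm)

theorem nonempty_of_card_vacantSites_le [Nonempty ι] (hV : #(vacantSites occ L z) ≤ 2 * L) :
    occ.Nonempty := by
  let l := Classical.arbitrary ι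
  obtain ⟨a, ha, hfull⟩ := exists_mem_forall_apply_ne (vacantSites occ L z)
    (Finset.Icc (z l - L) (z l + L)) l (by rw [Int.card_Icc]; omega)
  have hslab := onFullSlab_update (mem_window.2 fun i => by omega : z ∈ window z L) ha hfull
  exact ⟨_, hslab.2 _ hslab.1 rfl⟩

end Lattice

/-! ### Mutually visible blocks -/

noncomputable section Blocks

open scoped Finset Fin.CommRing

open Classical in
/-- The displacements `k` such that, in a cubic grid of mesh `c`, any two points of cells displaced
by `k` are within distance `1`. The range of the coordinates is cut off, without loss, to obtain a
`Finset`. -/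
def visibleSteps (d : ℕ) (c : ℝ) : Finset (Fin d → ℤ) :=
  (Fintype.piFinset fun _ => Finset.Icc (-⌈1 / c⌉) ⌈1 / c⌉).filter
    fun k => c ^ 2 * ∑ l, (|(k l : ℝ)| + 1) ^ 2 ≤ 1

theorem mem_visibleSteps {d : ℕ} {c : ℝ} (hc : 0 < c) {k : Fin d → ℤ} :
    k ∈ visibleSteps d c ↔ c ^ 2 * ∑ l, (|(k l : ℝ)| + 1) ^ 2 ≤ 1 := by
  simp only [visibleSteps, Finset.mem_filter, Fintype.mem_piFinset, Finset.mem_Icc,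
    and_iff_right_iff_imp]
  intro h l
  have hl : (|(k l : ℝ)| + 1) ^ 2 ≤ ∑ l, (|(k l : ℝ)| + 1) ^ 2 :=
    Finset.single_le_sum (f := fun l => (|(k l : ℝ)| + 1) ^ 2) (fun _ _ => sq_nonneg _)
      (Finset.mem_univ l)
  have hcl : c * (|(k l : ℝ)| + 1) ≤ 1 := by
    refine le_of_abs_le ((sq_le_one_iff_abs_le_one _).1 ?_)
    rw [mul_pow]
    exact (mul_le_mul_of_nonneg_left hl (sq_nonneg c)).trans h
  have hkl : |(k l : ℝ)| ≤ ⌈1 / c⌉ :=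
    (le_div_iff₀' hc).2 (by linarith) |>.trans (Int.le_ceil _)
  exact abs_le.1 (by exact_mod_cast hkl)

theorem isStepSet_visibleSteps {d : ℕ} {c : ℝ} (hc : 0 < c) (hcd : c ^ 2 * (d + 3) ≤ 1) :
    IsStepSet (visibleSteps d c) where
  unit_mem l := by
    have hsq (j) :
        (|((Pi.single l 1 : Fin d → ℤ) j : ℝ)| + 1) ^ 2 = 1 + if j = l then 3 else 0 := by
      rcases eq_or_ne j l with rfl | hj
      · norm_num
      · simp [hj]
    rw [mem_visibleSteps hc]
    simpa [hsq, Finset.sum_add_distrib] using hcd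
  single_mem k hk l a ha := by
    rw [mem_visibleSteps hc] at hk ⊢
    have hle (j) : |((Pi.single l a : Fin d → ℤ) j : ℝ)| ≤ |(k j : ℝ)| := by
      rcases eq_or_ne j l with rfl | hj
      · rw [Pi.single_eq_same]
        exact_mod_cast ha
      · simp [hj]
    refine le_trans ?_ hk
    gcongr c ^ 2 * ∑ j, (?_ + 1) ^ 2 with j
    exact hle j

theorem sum_abs_round_add_one_sq_le {d : ℕ} (x : EuclideanSpace ℝ (Fin d)) :
    ∑ l, (|(round (x l) : ℝ)| + 1) ^ 2 ≤ (‖x‖ + 3 / 2 * √d) ^ 2 := by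
  let absx : EuclideanSpace ℝ (Fin d) := WithLp.toLp 2 fun l => |x l|
  let const : EuclideanSpace ℝ (Fin d) := WithLp.toLp 2 fun _ => 3 / 2
  have norm_absx : ‖absx‖ = ‖x‖ := by simp [EuclideanSpace.norm_eq, absx]
  have norm_const : ‖const‖ = 3 / 2 * √d := by
    simp [EuclideanSpace.norm_eq, const, Real.sqrt_sq (by norm_num : (0 : ℝ) ≤ 3 / 2), mul_comm]
  calc ∑ l, (|(round (x l) : ℝ)| + 1) ^ 2 ≤ ∑ l, (|x l| + 3 / 2) ^ 2 := by
        gcongr ∑ l, (?_) ^ 2 with l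
        have h1 := abs_sub_round (x l)
        have h2 := abs_sub_abs_le_abs_sub (round (x l) : ℝ) (x l)
        rw [abs_sub_comm] at h2
        linarith
    _ = ‖absx + const‖ ^ 2 := by
        simp [EuclideanSpace.norm_sq_eq, absx, const]
    _ ≤ (‖absx‖ + ‖const‖) ^ 2 := by gcongr; exact norm_add_le _ _
    _ = (‖x‖ + 3 / 2 * √d) ^ 2 := by rw [norm_absx, norm_const]

theorem volume_ball_le_card_of_round_mem {d : ℕ} {R : ℝ} {T : Finset (Fin d → ℤ)}
    (h : ∀ x : EuclideanSpace ℝ (Fin d), ‖x‖ < R → (fun l => round (x l)) ∈ T) :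
    volume (Metric.ball (0 : EuclideanSpace ℝ (Fin d)) R) ≤ #T := by
  let cube (k : Fin d → ℤ) : Set (EuclideanSpace ℝ (Fin d)) :=
    WithLp.ofLp ⁻¹' Set.Icc (fun l => (k l : ℝ) - 1 / 2) (fun l => (k l : ℝ) + 1 / 2)
  have volume_cube (k) : volume (cube k) = 1 := by
    rw [(PiLp.volume_preserving_ofLp (Fin d)).measure_preimage
      measurableSet_Icc.nullMeasurableSet, Real.volume_Icc_pi]
    norm_num
  have hcover : Metric.ball (0 : EuclideanSpace ℝ (Fin d)) R ⊆ ⋃ k ∈ T, cube k := fun x hx => by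
    refine Set.mem_iUnion₂.2 ⟨_, h x (mem_ball_zero_iff.1 hx), fun l => ?_, fun l => ?_⟩ <;>
    · have := abs_le.1 (abs_sub_round (x l))
      simp only
      linarith
  calc volume (Metric.ball (0 : EuclideanSpace ℝ (Fin d)) R)
      ≤ ∑ k ∈ T, volume (cube k) := (measure_mono hcover).trans (measure_biUnion_finset_le _ _)
    _ = #T := by simp [volume_cube]

theorem unitBallVolume_mul_pow {d : ℕ} {R : ℝ} (hR : 0 < R) :
    unitBallVolume d * R ^ d = (volume (Metric.ball (0 : EuclideanSpace ℝ (Fin d)) R)).toReal := by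
  rw [Measure.addHaar_ball_of_pos _ _ hR, finrank_euclideanSpace, Fintype.card_fin,
    ENNReal.toReal_mul, ENNReal.toReal_ofReal (by positivity), mul_comm, unitBallVolume]

theorem unitBallVolume_pos (d : ℕ) : 0 < unitBallVolume d :=
  ENNReal.toReal_pos (Metric.measure_ball_pos _ _ one_pos).ne' measure_ball_lt_top.ne

theorem unitBallVolume_mul_pow_le_card_visibleSteps {d : ℕ} {c : ℝ} (hc : 0 < c)
    (hρ : 0 < 1 - 3 * √d * c / 2) :
    unitBallVolume d * (1 - 3 * √d * c / 2) ^ d ≤ c ^ d * #(visibleSteps d c) := by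
  have round_mem (x : EuclideanSpace ℝ (Fin d)) (hx : ‖x‖ < (1 - 3 * √d * c / 2) / c) :
      (fun l => round (x l)) ∈ visibleSteps d c := by
    rw [lt_div_iff₀ hc] at hx
    rw [mem_visibleSteps hc]
    calc c ^ 2 * ∑ l, (|(round (x l) : ℝ)| + 1) ^ 2
        ≤ c ^ 2 * (‖x‖ + 3 / 2 * √d) ^ 2 := by gcongr; exact sum_abs_round_add_one_sq_le x
      _ = (‖x‖ * c + 3 * √d * c / 2) ^ 2 := by ring
      _ ≤ 1 := pow_le_one₀ (by positivity) (by linarith)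
  have hcard := ENNReal.toReal_mono (ENNReal.natCast_ne_top _)
    (volume_ball_le_card_of_round_mem round_mem)
  rwa [← unitBallVolume_mul_pow (div_pos hρ hc), ENNReal.toReal_natCast, div_pow, mul_div_assoc',
    div_le_iff₀' (by positivity)] at hcard

theorem sideLength_nonneg (d n : ℕ) : 0 ≤ sideLength d n := by
  unfold sideLength
  positivity

theorem abs_min_abs_sub_abs_le {S u : ℝ} (hu : |u| ≤ S) (q : ℤ) :
    |min |u| (S - |u|)| ≤ |u - q * S| := by
  have hS : 0 ≤ S := (abs_nonneg u).trans hu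
  rw [abs_of_nonneg (le_min (abs_nonneg u) (sub_nonneg.2 hu))]
  rcases eq_or_ne q 0 with rfl | hq
  · simp
  · have hqS : S ≤ |q * S| := by
      rw [abs_mul, abs_of_nonneg hS]
      exact le_mul_of_one_le_left hS (by exact_mod_cast Int.one_le_abs hq)
    have := abs_sub_abs_le_abs_sub (q * S) u
    rw [abs_sub_comm] at this
    exact (min_le_right _ _).trans (by linarith)

theorem torusDist_le {d n : ℕ} {x y w : Fin d → ℝ} {R : ℝ} (hx : x ∈ region d n)
    (hy : y ∈ region d n) (q : Fin d → ℤ) (hR : 0 ≤ R)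
    (hw : ∀ l, |x l - y l - q l * sideLength d n| ≤ w l) (hsum : ∑ l, w l ^ 2 ≤ R ^ 2) :
    torusDist d n x y ≤ R := by
  refine Real.sqrt_le_iff.2 ⟨hR, (Finset.sum_le_sum fun l _ => ?_).trans hsum⟩
  have hu : |x l - y l| ≤ sideLength d n := by
    have := hx.1 l; have := hx.2 l; have := hy.1 l; have := hy.2 l
    exact abs_le.2 ⟨by linarith, by linarith⟩
  exact sq_le_sq' (abs_le.1 ((abs_min_abs_sub_abs_le hu (q l)).trans (hw l))).1
    ((le_abs_self _).trans ((abs_min_abs_sub_abs_le hu (q l)).trans (hw l)))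

/-- The side of the blocks. -/
def blockSide (d n : ℕ) (χ : ℝ) : ℝ := sideLength d n / blocksPerSide d n χ

theorem blockSide_nonneg (d n : ℕ) (χ : ℝ) : 0 ≤ blockSide d n χ :=
  div_nonneg (sideLength_nonneg d n) (Nat.cast_nonneg _)

variable {d n : ℕ} {χ : ℝ}

theorem blocksPerSide_mul_blockSide [NeZero (blocksPerSide d n χ)] :
    blocksPerSide d n χ * blockSide d n χ = sideLength d n :=
  mul_div_cancel₀ _ (NeZero.ne _)

theorem block_eq_pi (i : Fin d → Fin (blocksPerSide d n χ)) :
    block d n χ i = Set.pi Set.univ fun l =>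
      Set.Ico (-sideLength d n / 2 + i l * blockSide d n χ)
        (-sideLength d n / 2 + (i l + 1) * blockSide d n χ) := by
  ext x
  simp [block, blockSide]

theorem measurableSet_block (i : Fin d → Fin (blocksPerSide d n χ)) :
    MeasurableSet (block d n χ i) := by
  rw [block_eq_pi]
  exact MeasurableSet.univ_pi fun _ => measurableSet_Ico

theorem volume_block (i : Fin d → Fin (blocksPerSide d n χ)) :
    volume (block d n χ i) = ENNReal.ofReal (blockSide d n χ ^ d) := by
  rw [block_eq_pi, Real.volume_pi_Ico, ENNReal.ofReal_pow (blockSide_nonneg d n χ)]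
  have hside (l) : -sideLength d n / 2 + (i l + 1) * blockSide d n χ -
      (-sideLength d n / 2 + i l * blockSide d n χ) = blockSide d n χ := by ring
  simp only [hside, Finset.prod_const, Finset.card_univ, Fintype.card_fin]

theorem block_subset_region (i : Fin d → Fin (blocksPerSide d n χ)) :
    block d n χ i ⊆ region d n := by
  intro x hx
  rw [block_eq_pi, Set.mem_univ_pi] at hx
  have hcoord (l) : x l ∈ Set.Icc (-sideLength d n / 2) (sideLength d n / 2) := by
    have : NeZero (blocksPerSide d n χ) := ⟨(i l).pos.ne'⟩
    have hi : (i l : ℝ) + 1 ≤ blocksPerSide d n χ := by exact_mod_cast (i l).isLt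
    have hlower := mul_nonneg (Nat.cast_nonneg (α := ℝ) (i l)) (blockSide_nonneg d n χ)
    have hupper := mul_le_mul_of_nonneg_right hi (blockSide_nonneg d n χ)
    rw [blocksPerSide_mul_blockSide] at hupper
    obtain ⟨h1, h2⟩ := hx l
    exact ⟨by linarith, by linarith⟩
  exact ⟨fun l => (hcoord l).1, fun l => (hcoord l).2⟩

theorem disjoint_block {i j : Fin d → Fin (blocksPerSide d n χ)} (hij : i ≠ j) :
    Disjoint (block d n χ i) (block d n χ j) := by
  refine Set.disjoint_left.2 fun x hx hy => hij (funext fun l => Fin.ext ?_)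
  rw [block_eq_pi, Set.mem_univ_pi] at hx hy
  obtain ⟨hx1, hx2⟩ := hx l
  obtain ⟨hy1, hy2⟩ := hy l
  have hs := blockSide_nonneg d n χ
  have h1 : (i l : ℝ) < j l + 1 := lt_of_mul_lt_mul_right (by linarith) hs
  have h2 : (j l : ℝ) < i l + 1 := lt_of_mul_lt_mul_right (by linarith) hs
  norm_cast at h1 h2
  omega

/-- Reduction of lattice sites modulo `m`, as a displacement of the blocks of the torus. -/
def siteIndex (d m : ℕ) [NeZero m] : (Fin d → ℤ) →+ (Fin d → Fin m) :=
  (Int.castAddHom (Fin m)).compLeft (Fin d)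

theorem exists_add_siteIndex_eq {m : ℕ} [NeZero m] (i : Fin d → Fin m) (k : Fin d → ℤ) :
    ∃ q : Fin d → ℤ, ∀ l, (((i + siteIndex d m k) l : ℕ) : ℤ) = i l + k l + m * q l := by
  have hmod (l) : ((i l : ℕ) : ℤ) + k l ≡ ((i + siteIndex d m k) l : ℕ) [ZMOD m] := by
    rw [← CharP.intCast_eq_intCast (Fin m) m]
    simp [siteIndex]
  choose q hq using fun l => (hmod l).dvd
  exact ⟨q, fun l => by rw [← hq l]; ring⟩

theorem siteIndex_surjective (m : ℕ) [NeZero m] : Function.Surjective (siteIndex d m) :=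
  fun j => ⟨fun l => (j l : ℕ), funext fun l => by simp [siteIndex]⟩

theorem siteIndex_injOn_window {m L : ℕ} [NeZero m] (hLm : 2 * L < m) :
    Set.InjOn (siteIndex d m) (window (0 : Fin d → ℤ) L) := by
  intro k hk k' hk' h
  simp only [Finset.mem_coe, mem_window, Pi.zero_apply] at hk hk'
  ext l
  have hdvd : (m : ℤ) ∣ k' l - k l :=
    ((CharP.intCast_eq_intCast (Fin m) m).1 (congrFun h l)).dvd
  have := Int.eq_zero_of_abs_lt_dvd hdvd (by have := hk l; have := hk' l; grind)
  omega

theorem abs_coord_sub_le [NeZero (blocksPerSide d n χ)] {i j : Fin d → Fin (blocksPerSide d n χ)}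
    {k q : Fin d → ℤ} (hij : ∀ l, ((j l : ℕ) : ℤ) = i l + k l + blocksPerSide d n χ * q l)
    {x y : Fin d → ℝ} (hx : x ∈ block d n χ i) (hy : y ∈ block d n χ j) (l : Fin d) :
    |y l - x l - q l * sideLength d n| ≤ blockSide d n χ * (|(k l : ℝ)| + 1) := by
  rw [block_eq_pi, Set.mem_univ_pi] at hx hy
  obtain ⟨hx1, hx2⟩ := hx l
  obtain ⟨hy1, hy2⟩ := hy l
  have hs := blockSide_nonneg d n χ
  have hcorner : (j l : ℝ) * blockSide d n χ =
      i l * blockSide d n χ + k l * blockSide d n χ + q l * sideLength d n := by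
    have : ((j l : ℕ) : ℝ) = i l + k l + blocksPerSide d n χ * q l := by exact_mod_cast hij l
    rw [this, ← blocksPerSide_mul_blockSide (χ := χ)]
    ring
  have hoffset : |y l - x l - q l * sideLength d n - k l * blockSide d n χ| ≤ blockSide d n χ :=
    abs_le.2 ⟨by linarith, by linarith⟩
  have := abs_sub_abs_le_abs_sub (y l - x l - q l * sideLength d n) (k l * blockSide d n χ)
  rw [abs_mul, abs_of_nonneg hs] at this
  linarith

theorem mutuallyVisible_block_add [NeZero (blocksPerSide d n χ)] {c : ℝ} (hc : 0 < c)
    (hside : blockSide d n χ ≤ c * visRadius d n) {k : Fin d → ℤ} (hk : k ∈ visibleSteps d c)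
    (i : Fin d → Fin (blocksPerSide d n χ)) :
    MutuallyVisible d n (block d n χ i) (block d n χ (i + siteIndex d _ k)) := by
  refine MutuallyVisible.symm fun y hy x hx => ?_
  obtain ⟨q, hq⟩ := exists_add_siteIndex_eq i k
  have hs := blockSide_nonneg d n χ
  have hR : 0 ≤ visRadius d n := nonneg_of_mul_nonneg_right (hs.trans hside) hc
  refine torusDist_le (block_subset_region _ hy) (block_subset_region _ hx) q hR
    (abs_coord_sub_le hq hx hy) ?_
  calc ∑ l, (blockSide d n χ * (|(k l : ℝ)| + 1)) ^ 2
      = blockSide d n χ ^ 2 * ∑ l, (|(k l : ℝ)| + 1) ^ 2 := by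
        simp only [mul_pow, Finset.mul_sum]
    _ ≤ (c * visRadius d n) ^ 2 * ∑ l, (|(k l : ℝ)| + 1) ^ 2 := by gcongr
    _ = visRadius d n ^ 2 * (c ^ 2 * ∑ l, (|(k l : ℝ)| + 1) ^ 2) := by ring
    _ ≤ visRadius d n ^ 2 := mul_le_of_le_one_right (sq_nonneg _) ((mem_visibleSteps hc).1 hk)

end Blocks

/-! ### Connectivity of the visibility graph -/

section Visibility

open scoped Finset

variable {d n : ℕ} {χ δ : ℝ} [NeZero (blocksPerSide d n χ)] {T : Finset (Fin d → ℤ)} {L : ℕ}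
  {cnt : Set (Fin d → ℝ) → ℕ}

theorem visibilityGraph_reachable_of_adj
    (hvis : ∀ i, ∀ k ∈ T, MutuallyVisible d n (block d n χ i) (block d n χ (i + siteIndex d _ k)))
    {occ : Set (Fin d → ℤ)}
    (hocc : ∀ z ∈ occ, δ * Real.log n ≤ cnt (block d n χ (siteIndex d _ z))) {x y : Fin d → ℤ}
    (hx : x ∈ occ) (hy : y ∈ occ) (hadj : (stepGraph T occ).Adj x y) :
    (visibilityGraph d n χ δ cnt).Reachable ⟨siteIndex d _ x, hocc x hx⟩
      ⟨siteIndex d _ y, hocc y hy⟩ := by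
  have mutuallyVisible {x y : Fin d → ℤ} (h : y - x ∈ T) : MutuallyVisible d n
      (block d n χ (siteIndex d _ x)) (block d n χ (siteIndex d _ y)) := by
    simpa [← map_add] using hvis (siteIndex d _ x) _ h
  by_cases heq : siteIndex d (blocksPerSide d n χ) x = siteIndex d _ y
  · simp only [heq, SimpleGraph.Reachable.refl]
  · refine SimpleGraph.Adj.reachable ⟨fun h => heq (congrArg Subtype.val h), ?_⟩
    obtain ⟨-, ⟨-, -, h⟩ | ⟨-, -, h⟩⟩ := hadj
    exacts [mutuallyVisible h, (mutuallyVisible h).symm]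

theorem visibilityGraph_connected [Nontrivial (Fin d)] (hT : IsStepSet T)
    (hL : ∀ k ∈ T, ∀ l, (#T : ℤ) + |k l| ≤ L)
    (hvis : ∀ i, ∀ k ∈ T, MutuallyVisible d n (block d n χ i) (block d n χ (i + siteIndex d _ k)))
    (hV : ∀ z, #(vacantSites {z | δ * Real.log n ≤ cnt (block d n χ (siteIndex d _ z))} L z) <
      #T - 1) : (visibilityGraph d n χ δ cnt).Connected := by
  set occ := {z | δ * Real.log n ≤ cnt (block d n χ (siteIndex d _ z))}
  have hocc : ∀ z ∈ occ, δ * Real.log n ≤ cnt (block d n χ (siteIndex d _ z)) := fun _ h => h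
  have lift {x y : Fin d → ℤ} (hx : x ∈ occ) (hxy : (stepGraph T occ).Reachable x y)
      (hy : y ∈ occ) :
      (visibilityGraph d n χ δ cnt).Reachable ⟨siteIndex d _ x, hocc x hx⟩
        ⟨siteIndex d _ y, hocc y hy⟩ := by
    rw [SimpleGraph.reachable_iff_reflTransGen] at hxy
    induction hxy with
    | refl => rfl
    | @tail y y' hxy hadj ih =>
      rw [← SimpleGraph.reachable_iff_reflTransGen] at hxy
      have hyocc := mem_of_stepGraph_reachable hx hxy
      exact (ih hyocc).trans (visibilityGraph_reachable_of_adj hvis hocc hyocc hy hadj)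
  obtain ⟨z, hz⟩ := nonempty_of_card_vacantSites_le (occ := occ) (z := 0) (L := L) (by
    have l := Classical.arbitrary (Fin d)
    have := hL _ (hT.unit_mem l) l
    have := hV 0
    grind)
  refine @SimpleGraph.Connected.mk _ _ ?_ ⟨⟨_, hocc z hz⟩⟩
  rintro ⟨i, hi⟩ ⟨j, hj⟩
  obtain ⟨x, rfl⟩ := siteIndex_surjective _ i
  obtain ⟨y, rfl⟩ := siteIndex_surjective _ j
  exact lift hi (stepGraph_reachable_of_card_vacantSites_lt hT hL hV hi hj) hj

theorem exists_vacant_of_not_connected [Nontrivial (Fin d)] (hT : IsStepSet T)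
    (hL : ∀ k ∈ T, ∀ l, (#T : ℤ) + |k l| ≤ L)
    (hvis : ∀ i, ∀ k ∈ T, MutuallyVisible d n (block d n χ i) (block d n χ (i + siteIndex d _ k)))
    (hG : ¬ (visibilityGraph d n χ δ cnt).Connected) :
    ∃ i, ∃ F ∈ (window 0 L).powersetCard (#T - 1),
      ∀ k ∈ F, cnt (block d n χ (i + siteIndex d _ k)) < δ * Real.log n := by
  have hV := mt (visibilityGraph_connected hT hL hvis) hG
  push Not at hV
  obtain ⟨z, hz⟩ := hV
  obtain ⟨F, hF, hFcard⟩ := Finset.exists_subset_card_eq hz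
  refine ⟨siteIndex d _ z, F.map (Equiv.subRight z).toEmbedding,
    Finset.mem_powersetCard.2 ⟨?_, by rw [Finset.card_map, hFcard]⟩, ?_⟩ <;>
  simp only [Finset.subset_iff, Finset.forall_mem_map, Equiv.coe_toEmbedding, Equiv.subRight_apply]
  · intro y hy
    have hyw := mem_window.1 (mem_vacantSites.1 (hF hy)).1
    exact mem_window.2 fun l => by have := hyw l; simp only [Pi.sub_apply, Pi.zero_apply]; omega
  · intro y hy
    simpa [← map_add] using (mem_vacantSites.1 (hF hy)).2

end Visibility

/-! ### Lower tails of community counts -/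

section LowerTails

theorem lintegral_pow_poissonMeasure (a : ℝ≥0) {q : ℝ} (hq : 0 ≤ q) :
    ∫⁻ k, ENNReal.ofReal q ^ k ∂(poissonMeasure a) =
      ENNReal.ofReal (Real.exp (-(a * (1 - q)))) := by
  lift q to ℝ≥0 using hq
  have hsum := (hasSum_one_poissonMeasure (a * q)).mul_left (Real.exp (-(a * (1 - q))))
  rw [mul_one] at hsum
  rw [lintegral_countable', ← hsum.tsum_eq,
    ENNReal.ofReal_tsum_of_nonneg (fun k => by positivity) hsum.summable]
  refine tsum_congr fun k => ?_
  have hexp : Real.exp (-(a : ℝ)) = Real.exp (-(a * (1 - q))) * Real.exp (-(a * q)) := by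
    rw [← Real.exp_add]
    congr 1
    ring
  rw [poissonMeasure_singleton, ← ENNReal.ofReal_pow q.coe_nonneg,
    ← ENNReal.ofReal_mul (by positivity), hexp]
  congr 1
  push_cast
  ring

variable {Ω : Type*} [MeasurableSpace Ω] {μ : Measure Ω}

theorem lintegral_prod_eq_lintegral_pow_card {κ E : Type*} [Countable κ] [MeasurableSpace E]
    {L : κ → Ω → E} {J : Ω → Finset κ} (hL : ∀ u, Measurable (L u)) (hJ : Measurable J)
    (hL_indep : iIndepFun L μ) (hJL : IndepFun J (fun ω u => L u ω) μ) {f : E → ℝ≥0∞}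
    (hf : Measurable f) {c : ℝ≥0∞} (hc : ∀ u, ∫⁻ ω, f (L u ω) ∂μ = c) :
    ∫⁻ ω, ∏ u ∈ J ω, f (L u ω) ∂μ = ∫⁻ ω, c ^ (J ω).card ∂μ := by
  have := hL_indep.isProbabilityMeasure
  have hL' : Measurable fun ω u => L u ω := measurable_pi_lambda _ hL
  have hprod (F : Finset κ) : Measurable fun x : κ → E => ∏ u ∈ F, f (x u) :=
    Finset.measurable_prod F fun u _ => hf.comp (measurable_pi_apply u)
  have hg : Measurable fun p : Finset κ × (κ → E) => ∏ u ∈ p.1, f (p.2 u) :=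
    measurable_from_prod_countable_right hprod
  calc ∫⁻ ω, ∏ u ∈ J ω, f (L u ω) ∂μ
      = ∫⁻ p, ∏ u ∈ p.1, f (p.2 u) ∂(μ.map fun ω => (J ω, fun u => L u ω)) :=
        (lintegral_map hg (hJ.prodMk hL')).symm
    _ = ∫⁻ F, ∫⁻ x, ∏ u ∈ F, f (x u) ∂(μ.map fun ω u => L u ω) ∂(μ.map J) := by
        rw [(indepFun_iff_map_prod_eq_prod_map_map hJ.aemeasurable hL'.aemeasurable).1 hJL,
          lintegral_prod _ hg.aemeasurable]
    _ = ∫⁻ F, c ^ F.card ∂(μ.map J) := by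
        refine lintegral_congr fun F => ?_
        rw [lintegral_map (hprod F) hL', lintegral_prod_eq_prod_lintegral_of_indepFun F
          (fun u ω => f (L u ω)) (hL_indep.comp (fun _ => f) fun _ => hf) fun u => hf.comp (hL u)]
        simp only [hc, Finset.prod_const]
    _ = ∫⁻ ω, c ^ (J ω).card ∂μ := lintegral_map (measurable_of_countable _) hJ

theorem measure_le_le_exp_mul_lintegral_pow {X : Ω → ℕ} (hX : Measurable X) {t : ℝ} (ht : 0 ≤ t)
    (x : ℝ) : μ {ω | (X ω : ℝ) ≤ x} ≤
      ENNReal.ofReal (Real.exp (t * x)) * ∫⁻ ω, ENNReal.ofReal (Real.exp (-t)) ^ X ω ∂μ := by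
  have hpow : Measurable fun ω => ENNReal.ofReal (Real.exp (-t)) ^ X ω := hX.const_pow _
  rw [← lintegral_const_mul _ hpow, ← one_mul (μ _)]
  refine le_trans ?_ (mul_meas_ge_le_lintegral (hpow.const_mul _) 1)
  gcongr with ω
  intro hω
  rw [← ENNReal.ofReal_pow (Real.exp_pos _).le, ← ENNReal.ofReal_mul (Real.exp_pos _).le,
    ← Real.exp_nat_mul, ← Real.exp_add, ENNReal.one_le_ofReal, Real.one_le_exp_iff]
  have := mul_le_mul_of_nonneg_left hω ht
  linarith

end LowerTails

noncomputable section CommunityCounts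

open Classical in
/-- The indices of the points lying in `A`, for a configuration `c` consisting of the points
`c.2 0, …, c.2 (c.1 - 1)`. -/
def indicesIn {E : Type*} (A : Set E) (c : ℕ × (ℕ → E)) : Finset ℕ :=
  (Finset.range c.1).filter fun u => c.2 u ∈ A

theorem mem_indicesIn {E : Type*} {A : Set E} {c : ℕ × (ℕ → E)} {u : ℕ} :
    u ∈ indicesIn A c ↔ u < c.1 ∧ c.2 u ∈ A := by
  simp only [indicesIn, Finset.mem_filter, Finset.mem_range]

theorem measurable_indicesIn {E : Type*} [MeasurableSpace E] {A : Set E} (hA : MeasurableSet A) :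
    Measurable (indicesIn A) := by
  refine measurable_finset_iff.2 fun u => ?_
  simp only [mem_indicesIn]
  exact (measurable_fst (measurableSet_Ioi (a := u))).mem.and
    (((measurable_pi_apply u).comp measurable_snd) hA).mem

variable {Ω : Type*} {d k n : ℕ} {θ : GHCMParams k} {G : GraphSample Ω d k}

theorem GHCMParams.prior_le_one (θ : GHCMParams k) (i : Fin k) : θ.prior i ≤ 1 :=
  (Finset.single_le_sum (fun j _ => θ.prior_nonneg j) (Finset.mem_univ i)).trans_eq θ.prior_sum

/-- The vertices located in `A`, whatever their community. -/
def GraphSample.verticesIn (G : GraphSample Ω d k) (A : Set (Fin d → ℝ)) (ω : Ω) : Finset ℕ :=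
  indicesIn A (G.number ω, fun u => G.loc u ω)

theorem GraphSample.communityCount_eq_card_filter (i : Fin k) (ω : Ω) (A : Set (Fin d → ℝ)) :
    G.communityCount i ω A = ((G.verticesIn A ω).filter fun u => G.label u ω = i).card := by
  rw [communityCount, verticesIn, indicesIn, Finset.filter_filter]
  congr 1
  grind

theorem GraphSample.prod_verticesIn_ite {M : Type*} [CommMonoid M] (i : Fin k) (ω : Ω)
    (A : Set (Fin d → ℝ)) (q : M) :
    ∏ u ∈ G.verticesIn A ω, (if G.label u ω = i then q else 1) = q ^ G.communityCount i ω A := by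
  rw [Finset.prod_ite, Finset.prod_const, Finset.prod_const_one, mul_one,
    communityCount_eq_card_filter]

theorem GraphSample.communityCount_biUnion_le {ι : Type*} (S : Finset ι)
    (A : ι → Set (Fin d → ℝ)) (i : Fin k) (ω : Ω) :
    G.communityCount i ω (⋃ j ∈ S, A j) ≤ ∑ j ∈ S, G.communityCount i ω (A j) := by
  classical
  simp only [communityCount_eq_card_filter]
  refine (Finset.card_le_card fun u hu => ?_).trans Finset.card_biUnion_le
  simp only [Finset.mem_filter, verticesIn, mem_indicesIn, Set.mem_iUnion₂,
    Finset.mem_biUnion] at hu ⊢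
  obtain ⟨⟨hu, j, hj, huj⟩, hlabel⟩ := hu
  exact ⟨j, hj, ⟨hu, huj⟩, hlabel⟩

variable [MeasurableSpace Ω] {μ : Measure Ω} {A : Set (Fin d → ℝ)}

theorem IsGHCM.measurable_verticesIn (hG : IsGHCM μ θ d n G) (hA : MeasurableSet A) :
    Measurable (G.verticesIn A) :=
  (measurable_indicesIn hA).comp (hG.loc_poisson.measurable_number.prodMk
    (measurable_pi_lambda _ hG.loc_poisson.measurable_point))

theorem IsGHCM.measurable_communityCount (hG : IsGHCM μ θ d n G) (i : Fin k)
    (hA : MeasurableSet A) : Measurable fun ω => G.communityCount i ω A := by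
  simp only [GraphSample.communityCount_eq_card_filter]
  refine Measurable.comp (g := Finset.card) (by fun_prop) (measurable_finset_iff.2 fun u => ?_)
  simp only [Finset.mem_filter]
  exact (measurable_finset_iff.1 (hG.measurable_verticesIn hA) u).and
    (hG.label_measurable u (measurableSet_singleton i)).mem

theorem IsGHCM.lintegral_label (hG : IsGHCM μ θ d n G) (i : Fin k) (u : ℕ) {q : ℝ} (hq : 0 ≤ q) :
    ∫⁻ ω, (if G.label u ω = i then ENNReal.ofReal q else 1) ∂μ =
      ENNReal.ofReal (1 - θ.prior i * (1 - q)) := by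
  have := hG.label_iIndep.isProbabilityMeasure
  have hm : MeasurableSet {ω | G.label u ω = i} := hG.label_measurable u (measurableSet_singleton i)
  have hcompl : μ {ω | G.label u ω = i}ᶜ = ENNReal.ofReal (1 - θ.prior i) := by
    rw [prob_compl_eq_one_sub hm, hG.label_law, ENNReal.ofReal_sub _ (θ.prior_nonneg i),
      ENNReal.ofReal_one]
  calc ∫⁻ ω, (if G.label u ω = i then ENNReal.ofReal q else 1) ∂μ
      = ENNReal.ofReal q * ENNReal.ofReal (θ.prior i) + ENNReal.ofReal (1 - θ.prior i) := by
        have h := lintegral_piecewise (μ := μ) hm (fun _ => ENNReal.ofReal q) fun _ => 1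
        rwa [setLIntegral_const, setLIntegral_const, hcompl, hG.label_law, one_mul] at h
    _ = ENNReal.ofReal (1 - θ.prior i * (1 - q)) := by
        rw [← ENNReal.ofReal_mul hq, ← ENNReal.ofReal_add (mul_nonneg hq (θ.prior_nonneg i))
          (sub_nonneg.2 (θ.prior_le_one i))]
        ring_nf

theorem IsGHCM.lintegral_pow_communityCount_eq (hG : IsGHCM μ θ d n G) (i : Fin k)
    (hA : MeasurableSet A) {q : ℝ} (hq : 0 ≤ q) :
    ∫⁻ ω, ENNReal.ofReal q ^ G.communityCount i ω A ∂μ =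
      ∫⁻ ω, ENNReal.ofReal (1 - θ.prior i * (1 - q)) ^ pointCount G.number G.loc A ω ∂μ := by
  simp only [← GraphSample.prod_verticesIn_ite]
  exact lintegral_prod_eq_lintegral_pow_card (f := fun x => if x = i then ENNReal.ofReal q else 1)
    hG.label_measurable (hG.measurable_verticesIn hA) hG.label_iIndep
    (hG.label_indep_loc.symm.comp (measurable_indicesIn hA) measurable_id)
    (measurable_of_finite _) fun u => hG.lintegral_label i u hq

theorem IsGHCM.lintegral_pow_communityCount (hG : IsGHCM μ θ d n G) (i : Fin k)
    (hA : MeasurableSet A) (hAr : A ⊆ region d n) {q : ℝ} (hq : 0 ≤ q) :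
    ∫⁻ ω, ENNReal.ofReal q ^ G.communityCount i ω A ∂μ =
      ENNReal.ofReal (Real.exp (-(θ.prior i * θ.lam * volume.real A * (1 - q)))) := by
  have hlaw := hG.loc_poisson.count_law A hA
  have hcount : AEMeasurable (pointCount G.number G.loc A) μ :=
    aemeasurable_of_map_neZero (by rw [hlaw]; infer_instance)
  have hprob : 0 ≤ 1 - θ.prior i * (1 - q) := by
    have := mul_nonneg (θ.prior_nonneg i) hq
    linarith [θ.prior_le_one i]
  rw [hG.lintegral_pow_communityCount_eq i hA hq,
    ← lintegral_map' (f := fun m => ENNReal.ofReal (1 - θ.prior i * (1 - q)) ^ m)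
      (measurable_of_countable _).aemeasurable hcount, hlaw, lintegral_pow_poissonMeasure _ hprob]
  congr 2
  rw [Measure.smul_apply, Measure.restrict_apply hA, Set.inter_eq_left.2 hAr, smul_eq_mul,
    ENNReal.coe_toNNReal_eq_toReal, ENNReal.toReal_mul, ENNReal.toReal_ofReal θ.lam_pos.le,
    ← measureReal_def]
  ring

theorem IsGHCM.communityCount_le_le (hG : IsGHCM μ θ d n G) (i : Fin k) (hA : MeasurableSet A)
    (hAr : A ⊆ region d n) {t : ℝ} (ht : 0 ≤ t) (x : ℝ) :
    μ {ω | (G.communityCount i ω A : ℝ) ≤ x} ≤ ENNReal.ofReal (Real.exp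
      (t * x - θ.prior i * θ.lam * volume.real A * (1 - Real.exp (-t)))) := by
  refine (measure_le_le_exp_mul_lintegral_pow (hG.measurable_communityCount i hA) ht x).trans_eq ?_
  rw [hG.lintegral_pow_communityCount i hA hAr (Real.exp_pos _).le,
    ← ENNReal.ofReal_mul (Real.exp_pos _).le, ← Real.exp_add, ← sub_eq_add_neg]

theorem IsGHCM.measure_forall_communityCount_le_le (hG : IsGHCM μ θ d n G) (i : Fin k)
    {ι : Type*} {S : Finset ι} {B : ι → Set (Fin d → ℝ)} (hB : ∀ j ∈ S, MeasurableSet (B j))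
    (hBr : ∀ j ∈ S, B j ⊆ region d n) (hdisj : (S : Set ι).PairwiseDisjoint B) {t : ℝ}
    (ht : 0 ≤ t) (x : ℝ) :
    μ {ω | ∀ j ∈ S, (G.communityCount i ω (B j) : ℝ) ≤ x} ≤ ENNReal.ofReal (Real.exp
      (t * (S.card * x) -
        θ.prior i * θ.lam * (∑ j ∈ S, volume.real (B j)) * (1 - Real.exp (-t)))) := by
  have hfin (j) (hj : j ∈ S) : volume (B j) ≠ ∞ :=
    measure_ne_top_of_subset (hBr j hj) isCompact_Icc.measure_ne_top
  rw [← measureReal_biUnion_finset hdisj hB hfin]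
  refine le_trans (measure_mono fun ω hω => ?_) (hG.communityCount_le_le i
    (Finset.measurableSet_biUnion S hB) (Set.iUnion₂_subset hBr) ht _)
  calc (G.communityCount i ω (⋃ j ∈ S, B j) : ℝ)
      ≤ ∑ j ∈ S, (G.communityCount i ω (B j) : ℝ) := by
        exact_mod_cast G.communityCount_biUnion_le S B i ω
    _ ≤ S.card * x := by simpa using Finset.sum_le_card_nsmul S _ x hω

end CommunityCounts

/-! ### The union bound -/

section UnionBound

open scoped Finset

variable {Ω : Type*} [MeasurableSpace Ω] {μ : Measure Ω} {d k n L : ℕ} {θ : GHCMParams k}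
  {G : GraphSample Ω d k} {χ δ t : ℝ} {T : Finset (Fin d → ℤ)} [NeZero (blocksPerSide d n χ)]

theorem IsGHCM.measure_vacant_le (hG : IsGHCM μ θ d n G) (i : Fin k)
    (hLm : 2 * L < blocksPerSide d n χ) (j : Fin d → Fin (blocksPerSide d n χ))
    {F : Finset (Fin d → ℤ)} (hF : F ⊆ window 0 L) (ht : 0 ≤ t) :
    μ {ω | ∀ z ∈ F, (G.communityCount i ω (block d n χ (j + siteIndex d _ z)) : ℝ) <
        δ * Real.log n} ≤
      ENNReal.ofReal (Real.exp (#F * (t * (δ * Real.log n) -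
        θ.prior i * θ.lam * blockSide d n χ ^ d * (1 - Real.exp (-t))))) := by
  have hdisj : (F : Set (Fin d → ℤ)).PairwiseDisjoint
      fun z => block d n χ (j + siteIndex d _ z) := fun z hz z' hz' hne =>
    disjoint_block fun h => hne (siteIndex_injOn_window hLm (hF hz) (hF hz') (add_left_cancel h))
  have hvol (z) : volume.real (block d n χ (j + siteIndex d _ z)) = blockSide d n χ ^ d := by
    rw [measureReal_def, volume_block, ENNReal.toReal_ofReal (pow_nonneg (blockSide_nonneg ..) d)]
  refine (measure_mono fun ω hω z hz => (hω z hz).le).trans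
    ((hG.measure_forall_communityCount_le_le i (fun z _ => measurableSet_block _)
      (fun z _ => block_subset_region _) hdisj ht _).trans_eq ?_)
  simp only [hvol, Finset.sum_const, nsmul_eq_mul]
  ring_nf

theorem IsGHCM.measure_not_connected_le [Nontrivial (Fin d)] (hG : IsGHCM μ θ d n G) (i : Fin k)
    (hT : IsStepSet T) (hL : ∀ z ∈ T, ∀ l, (#T : ℤ) + |z l| ≤ L)
    (hvis : ∀ j, ∀ z ∈ T, MutuallyVisible d n (block d n χ j) (block d n χ (j + siteIndex d _ z)))
    (hLm : 2 * L < blocksPerSide d n χ) (ht : 0 ≤ t) :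
    μ {ω | ¬ (visibilityGraph d n χ δ (G.communityCount i ω)).Connected} ≤
      ENNReal.ofReal ((blocksPerSide d n χ : ℝ) ^ d *
        (#((window (0 : Fin d → ℤ) L).powersetCard (#T - 1)) *
        Real.exp ((#T - 1 : ℕ) * (t * (δ * Real.log n) -
          θ.prior i * θ.lam * blockSide d n χ ^ d * (1 - Real.exp (-t)))))) := by
  set W := (window (0 : Fin d → ℤ) L).powersetCard (#T - 1)
  set p := Real.exp ((#T - 1 : ℕ) * (t * (δ * Real.log n) -
    θ.prior i * θ.lam * blockSide d n χ ^ d * (1 - Real.exp (-t))))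
  let vacant (j : Fin d → Fin (blocksPerSide d n χ)) (F : Finset (Fin d → ℤ)) : Set Ω :=
    {ω | ∀ z ∈ F, (G.communityCount i ω (block d n χ (j + siteIndex d _ z)) : ℝ) < δ * Real.log n}
  have hvacant : ∀ q ∈ Finset.univ ×ˢ W, μ (vacant q.1 q.2) ≤ ENNReal.ofReal p := by
    intro q hq
    obtain ⟨hF, hcard⟩ := Finset.mem_powersetCard.1 (Finset.mem_product.1 hq).2
    simpa only [hcard] using hG.measure_vacant_le i hLm q.1 hF ht
  calc μ {ω | ¬ (visibilityGraph d n χ δ (G.communityCount i ω)).Connected}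
      ≤ μ (⋃ q ∈ Finset.univ ×ˢ W, vacant q.1 q.2) := measure_mono fun ω hω => by
        obtain ⟨j, F, hF, hlt⟩ := exists_vacant_of_not_connected hT hL hvis hω
        exact Set.mem_biUnion (x := (j, F)) (Finset.mem_product.2 ⟨Finset.mem_univ _, hF⟩) hlt
    _ ≤ ∑ q ∈ Finset.univ ×ˢ W, μ (vacant q.1 q.2) := measure_biUnion_finset_le _ _
    _ ≤ #(Finset.univ ×ˢ W) • ENNReal.ofReal p := Finset.sum_le_card_nsmul _ _ _ hvacant
    _ = ENNReal.ofReal ((blocksPerSide d n χ : ℝ) ^ d * (#W * p)) := by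
        rw [← ENNReal.ofReal_nsmul]
        simp [Finset.card_product, mul_assoc]

end UnionBound

/-! ### Asymptotics -/

section Asymptotics

variable {d : ℕ} {χ : ℝ}

theorem sideLength_pow (hd : d ≠ 0) (n : ℕ) : sideLength d n ^ d = n := by
  rw [sideLength, one_div, Real.rpow_inv_natCast_pow (Nat.cast_nonneg n) hd]

theorem tendsto_log_natCast_atTop : Tendsto (fun n : ℕ => Real.log n) atTop atTop :=
  Real.tendsto_log_atTop.comp tendsto_natCast_atTop_atTop

theorem tendsto_div_log_rpow_atTop (hd : d ≠ 0) (hχ : 0 < χ) :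
    Tendsto (fun n : ℕ => ((n : ℝ) / (χ * Real.log n)) ^ (1 / (d : ℝ))) atTop atTop := by
  have hlog : Tendsto (fun x : ℝ => Real.log x / x) atTop (𝓝[>] 0) := by
    refine tendsto_nhdsWithin_iff.2 ⟨Real.isLittleO_log_id_atTop.tendsto_div_nhds_zero, ?_⟩
    filter_upwards [eventually_gt_atTop 1] with x hx
    exact div_pos (Real.log_pos hx) (by linarith)
  have hratio : Tendsto (fun n : ℕ => (n : ℝ) / (χ * Real.log n)) atTop atTop := by
    refine ((hlog.inv_tendsto_nhdsGT_zero.comp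
      tendsto_natCast_atTop_atTop).atTop_div_const hχ).congr fun n => ?_
    rw [Function.comp, Pi.inv_apply, inv_div, div_div, mul_comm]
  exact (tendsto_rpow_atTop (by positivity)).comp hratio

theorem tendsto_blocksPerSide_atTop (hd : d ≠ 0) (hχ : 0 < χ) :
    Tendsto (fun n : ℕ => blocksPerSide d n χ) atTop atTop :=
  tendsto_nat_ceil_atTop.comp (tendsto_div_log_rpow_atTop hd hχ)

theorem tendsto_blockSide_pow_div_log (hd : d ≠ 0) (hχ : 0 < χ) :
    Tendsto (fun n : ℕ => blockSide d n χ ^ d / Real.log n) atTop (𝓝 χ) := by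
  have hceil := ((((tendsto_nat_ceil_div_atTop (R := ℝ)).comp
    (tendsto_div_log_rpow_atTop hd hχ)).inv₀ one_ne_zero).pow d).mul_const χ
  rw [inv_one, one_pow, one_mul] at hceil
  refine hceil.congr' ?_
  filter_upwards [eventually_gt_atTop 1] with n hn
  have hlog : 0 < Real.log n := Real.log_pos (by exact_mod_cast hn)
  rw [Function.comp, inv_div, div_pow, blockSide, div_pow, sideLength_pow hd, blocksPerSide,
    one_div, Real.rpow_inv_natCast_pow (by positivity) hd]
  field_simp

theorem blockSide_le {n : ℕ} (hn : 1 < n) (hχ : 0 < χ) :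
    blockSide d n χ ≤ χ ^ (1 / (d : ℝ)) * visRadius d n := by
  have hlog : 0 < Real.log n := Real.log_pos (by exact_mod_cast hn)
  have hpos : 0 < ((n : ℝ) / (χ * Real.log n)) ^ (1 / (d : ℝ)) := by positivity
  calc blockSide d n χ
      ≤ sideLength d n / ((n : ℝ) / (χ * Real.log n)) ^ (1 / (d : ℝ)) :=
        div_le_div_of_nonneg_left (sideLength_nonneg d n) hpos (Nat.le_ceil _)
    _ = χ ^ (1 / (d : ℝ)) * visRadius d n := by
        rw [visRadius, ← Real.mul_rpow hχ.le hlog.le, sideLength,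
          ← Real.div_rpow (by positivity) (by positivity)]
        congr 1
        field_simp

theorem eventually_blocksPerSide_pow_le (hd : d ≠ 0) (hχ : 0 < χ) :
    ∀ᶠ n : ℕ in atTop, (blocksPerSide d n χ : ℝ) ^ d ≤ n := by
  have hvol : Tendsto (fun n : ℕ => blockSide d n χ ^ d) atTop atTop := by
    refine ((tendsto_blockSide_pow_div_log hd hχ).pos_mul_atTop hχ
      tendsto_log_natCast_atTop).congr' ?_
    filter_upwards [eventually_gt_atTop 1] with n hn
    exact div_mul_cancel₀ _ (Real.log_pos (by exact_mod_cast hn)).ne'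
  filter_upwards [hvol.eventually_ge_atTop 1,
    (tendsto_blocksPerSide_atTop hd hχ).eventually_ne_atTop 0] with n hn hm
  have : NeZero (blocksPerSide d n χ) := ⟨hm⟩
  calc (blocksPerSide d n χ : ℝ) ^ d
      ≤ (blocksPerSide d n χ : ℝ) ^ d * blockSide d n χ ^ d :=
        le_mul_of_one_le_right (by positivity) hn
    _ = n := by rw [← mul_pow, blocksPerSide_mul_blockSide, sideLength_pow hd]

theorem tendsto_blocksPerSide_pow_mul_exp (hd : d ≠ 0) (hχ : 0 < χ) {C K r t δ : ℝ} (hC : 0 ≤ C)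
    (h : 1 + K * (t * δ - r * χ * (1 - Real.exp (-t))) < 0) :
    Tendsto (fun n : ℕ => (blocksPerSide d n χ : ℝ) ^ d * (C * Real.exp
      (K * (t * (δ * Real.log n) - r * blockSide d n χ ^ d * (1 - Real.exp (-t))))))
      atTop (𝓝 0) := by
  set rate : ℕ → ℝ := fun n =>
    1 + K * (t * δ - r * (blockSide d n χ ^ d / Real.log n) * (1 - Real.exp (-t)))
  have hrate : Tendsto rate atTop (𝓝 (1 + K * (t * δ - r * χ * (1 - Real.exp (-t))))) :=
    ((((tendsto_blockSide_pow_div_log hd hχ).const_mul r).mul_const _).const_sub _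
      |>.const_mul K).const_add 1
  have hbound : Tendsto (fun n : ℕ => C * Real.exp (rate n * Real.log n)) atTop (𝓝 0) := by
    simpa using (Real.tendsto_exp_atBot.comp
      (hrate.neg_mul_atTop h tendsto_log_natCast_atTop)).const_mul C
  refine squeeze_zero' (.of_forall fun n => by positivity) ?_ hbound
  filter_upwards [eventually_gt_atTop 1, eventually_blocksPerSide_pow_le hd hχ] with n hn hm
  have hlog : 0 < Real.log n := Real.log_pos (by exact_mod_cast hn)
  refine (mul_le_mul_of_nonneg_right hm (by positivity)).trans_eq ?_
  nth_rw 1 [← Real.exp_log (show (0 : ℝ) < n by positivity)]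
  rw [mul_left_comm, ← Real.exp_add]
  congr 2
  simp only [rate]
  field_simp

theorem tendsto_measure_one_of_compl {Ω : ℕ → Type*} [∀ n, MeasurableSpace (Ω n)]
    {μ : ∀ n, Measure (Ω n)} [∀ n, IsProbabilityMeasure (μ n)] {s : ∀ n, Set (Ω n)}
    (h : Tendsto (fun n => μ n (s n)ᶜ) atTop (𝓝 0)) : Tendsto (fun n => μ n (s n)) atTop (𝓝 1) := by
  refine tendsto_of_tendsto_of_tendsto_of_le_of_le
    (by simpa using ENNReal.Tendsto.sub tendsto_const_nhds h (Or.inl ENNReal.one_ne_top))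
    tendsto_const_nhds (fun n => ?_) fun n => prob_le_one
  rw [tsub_le_iff_right, ← measure_univ (μ := μ n)]
  exact measure_univ_le_add_compl _

end Asymptotics

/-! ### Connectivity with high probability -/

section Threshold

open scoped Finset

variable {d : ℕ} {r χ : ℝ}

theorem ChiCondition.radiusConst_pos (hχ : ChiCondition d r χ) : 0 < radiusConst d χ := by
  have hρ := hχ.radius_pos
  have : 0 ≤ √d * χ ^ (1 / (d : ℝ)) :=
    mul_nonneg (Real.sqrt_nonneg d) (Real.rpow_nonneg hχ.pos.le _)
  unfold radiusConst
  linarith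

theorem ChiCondition.sq_mul_add_three_le_one (hd : 2 ≤ d) (hr : 0 < r) (hχ : ChiCondition d r χ) :
    (χ ^ (1 / (d : ℝ))) ^ 2 * (d + 3) ≤ 1 := by
  have hρ := hχ.radius_pos
  have hvol := hχ.volume_cond
  have hd' : (2 : ℝ) ≤ d := by exact_mod_cast hd
  have hr' : 0 < 1 / r := by positivity
  have hc : 0 < χ ^ (1 / (d : ℝ)) := Real.rpow_pos_of_pos hχ.pos _
  set c := χ ^ (1 / (d : ℝ))
  have hdc : 0 ≤ √d * c := by positivity
  have hhalf : 1 / 2 < (1 - 3 * √d * c / 2) ^ 2 := by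
    have hpow : (1 - 3 * √d * c / 2) ^ d ≤ (1 - 3 * √d * c / 2) ^ 2 :=
      pow_le_pow_of_le_one hρ.le (by linarith) hd
    by_contra! h
    nlinarith [mul_le_mul_of_nonneg_left (hpow.trans h) (unitBallVolume_pos d).le]
  have hsmall : √d * c < 1 / 5 := by nlinarith
  have hsq : c ^ 2 * d < 1 / 25 := by
    have := pow_lt_pow_left₀ hsmall hdc two_ne_zero
    rw [mul_pow, Real.sq_sqrt (Nat.cast_nonneg d)] at this
    linarith
  nlinarith [mul_le_mul_of_nonneg_left hd' (sq_nonneg c)]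

theorem ChiCondition.one_lt_mul_card_visibleSteps (hd : d ≠ 0) (hr : 0 < r)
    (hχ : ChiCondition d r χ) :
    1 < r * χ * (#(visibleSteps d (χ ^ (1 / (d : ℝ)))) - 1) := by
  have hball := unitBallVolume_mul_pow_le_card_visibleSteps
    (Real.rpow_pos_of_pos hχ.pos (1 / (d : ℝ))) hχ.radius_pos
  rw [one_div, Real.rpow_inv_natCast_pow hχ.pos.le hd, ← one_div] at hball
  have hvol := hχ.volume_cond
  have hlt := hχ.lt
  have : 1 / r < χ * (#(visibleSteps d (χ ^ (1 / (d : ℝ)))) - 1) := by linarith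
  rwa [div_lt_iff₀' hr, ← mul_assoc] at this

theorem exists_pos_one_lt_mul_one_sub_exp_neg {a : ℝ} (ha : 1 < a) :
    ∃ t, 0 < t ∧ 1 < a * (1 - Real.exp (-t)) := by
  have hlim : Tendsto (fun t => a * (1 - Real.exp (-t))) atTop (𝓝 a) := by
    simpa using (Real.tendsto_exp_neg_atTop_nhds_zero.const_sub 1).const_mul a
  exact ((eventually_gt_atTop 0).and (hlim.eventually_const_lt ha)).exists

theorem exists_forall_card_add_abs_le (T : Finset (Fin d → ℤ)) :
    ∃ L : ℕ, ∀ z ∈ T, ∀ l, (#T : ℤ) + |z l| ≤ L := by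
  refine ⟨#T + T.sup fun z => Finset.univ.sup fun l => (z l).natAbs, fun z hz l => ?_⟩
  have hl := Finset.le_sup (f := fun l => (z l).natAbs) (Finset.mem_univ l)
  have hz := Finset.le_sup (f := fun z : Fin d → ℤ => Finset.univ.sup fun l => (z l).natAbs) hz
  rw [Int.abs_eq_natAbs]
  exact_mod_cast Nat.add_le_add_left (hl.trans hz) _

theorem tendsto_measure_connected (hd : 2 ≤ d) (hχ : 0 < χ)
    (hc : (χ ^ (1 / (d : ℝ))) ^ 2 * (d + 3) ≤ 1) {k : ℕ} {θ : GHCMParams k} {i : Fin k} {t δ : ℝ}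
    (ht : 0 ≤ t) (hrate : 1 + (#(visibleSteps d (χ ^ (1 / (d : ℝ)))) - 1) *
      (t * δ - θ.prior i * θ.lam * χ * (1 - Real.exp (-t))) < 0)
    {Ω : ℕ → Type*} [∀ n, MeasurableSpace (Ω n)] {μ : ∀ n, Measure (Ω n)}
    {G : ∀ n, GraphSample (Ω n) d k} (hG : ∀ n, IsGHCM (μ n) θ d n (G n)) :
    Tendsto (fun n => μ n {ω | (visibilityGraph d n χ δ ((G n).communityCount i ω)).Connected})
      atTop (𝓝 1) := by
  have hd0 : d ≠ 0 := by omega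
  have := Fin.nontrivial_iff_two_le.2 hd
  have hprob (n) : IsProbabilityMeasure (μ n) := (hG n).label_iIndep.isProbabilityMeasure
  set T := visibleSteps d (χ ^ (1 / (d : ℝ)))
  have hc0 : 0 < χ ^ (1 / (d : ℝ)) := Real.rpow_pos_of_pos hχ _
  have hT : IsStepSet T := isStepSet_visibleSteps hc0 hc
  obtain ⟨L, hL⟩ := exists_forall_card_add_abs_le T
  have hcard : ((#T - 1 : ℕ) : ℝ) = #T - 1 :=
    Nat.cast_pred (Finset.card_pos.2 ⟨_, hT.unit_mem ⟨0, by omega⟩⟩)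
  rw [← hcard] at hrate
  have hbound := ENNReal.tendsto_ofReal (tendsto_blocksPerSide_pow_mul_exp hd0 hχ
    (Nat.cast_nonneg #((window (0 : Fin d → ℤ) L).powersetCard (#T - 1))) hrate)
  rw [ENNReal.ofReal_zero] at hbound
  refine tendsto_measure_one_of_compl (tendsto_of_tendsto_of_tendsto_of_le_of_le'
    tendsto_const_nhds hbound (.of_forall fun n => zero_le) ?_)
  filter_upwards [eventually_gt_atTop 1,
    (tendsto_blocksPerSide_atTop hd0 hχ).eventually_gt_atTop (2 * L)] with n hn hm
  have : NeZero (blocksPerSide d n χ) := ⟨by omega⟩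
  exact (hG n).measure_not_connected_le i hT hL
    (fun j z hz => mutuallyVisible_block_add hc0 (blockSide_le hn hχ) hz j) hm ht

end Threshold

theorem mainTheorem2_general (d : ℕ) (hd : 2 ≤ d) (r χ : ℝ) (hr : 0 < r)
    (hχ : ChiCondition d r χ) :
    ∃ δt : ℝ, 0 < δt ∧
      ∀ {k : ℕ} (θ : GHCMParams k) (i : Fin k), θ.prior i * θ.lam = r →
      ∀ δ : ℝ, δ < δt * χ / (unitBallVolume d * radiusConst d χ) →
      ∀ (Ω : ℕ → Type*) [∀ n, MeasurableSpace (Ω n)] (μ : ∀ n, Measure (Ω n))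
        (G : ∀ n, GraphSample (Ω n) d k), (∀ n, IsGHCM (μ n) θ d n (G n)) →
        Tendsto (fun n => μ n
          {ω | (visibilityGraph d n χ δ ((G n).communityCount i ω)).Connected}) atTop (𝓝 1) := by
  set K : ℝ := (visibleSteps d (χ ^ (1 / (d : ℝ)))).card - 1
  have ha : 1 < r * χ * K := hχ.one_lt_mul_card_visibleSteps (by omega) hr
  obtain ⟨t, ht, hat⟩ := exists_pos_one_lt_mul_one_sub_exp_neg ha
  have hχ0 := hχ.pos
  have hK : 0 < K := pos_of_mul_pos_right (one_pos.trans ha) (by positivity)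
  have hν := unitBallVolume_pos d
  have hR := hχ.radiusConst_pos
  refine ⟨(r * χ * K * (1 - Real.exp (-t)) - 1) / (K * t) *
    (unitBallVolume d * radiusConst d χ) / χ, by have := sub_pos.2 hat; positivity, ?_⟩
  intro k θ i hθ δ hδ Ω _ μ G hG
  rw [div_mul_cancel₀ _ hχ0.ne', mul_div_cancel_right₀ _ (by positivity),
    lt_div_iff₀ (by positivity)] at hδ
  refine tendsto_measure_connected hd hχ0 (hχ.sq_mul_add_three_le_one hd hr) ht.le ?_ hG
  rw [hθ]
  linarith

theorem mainTheorem2 (d : ℕ) (hd : 2 ≤ d) (r χ : ℝ) (hr : 0 < r) (hχ : ChiCondition d r χ) :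
    ∃ δt : ℝ, 0 < δt ∧
      ∀ θ : GHCMParams 2, θ.prior 0 * θ.lam = r →
        θ.obsLaw 0 0 ≠ θ.obsLaw 0 1 → θ.obsLaw 1 0 = θ.obsLaw 1 1 →
        1 < θ.lam * unitBallVolume d * θ.minDivergence →
      ∀ δ : ℝ, 0 < δ → δ < δt * χ / (unitBallVolume d * radiusConst d χ) →
      ∀ (Ω : ℕ → Type*) [∀ n, MeasurableSpace (Ω n)] (μ : ∀ n, Measure (Ω n))
        [∀ n, IsProbabilityMeasure (μ n)] (G : ∀ n, GraphSample (Ω n) d 2),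
        (∀ n, IsGHCM (μ n) θ d n (G n)) →
        Tendsto (fun n => μ n {ω | ((G n).cstarVisibilityGraph n χ δ ω).Connected})
          atTop (𝓝 1) :=
  let ⟨δt, hδt, h⟩ := mainTheorem2_general d hd r χ hr hχ
  ⟨δt, hδt, fun θ hθ _ _ _ δ _ hδ Ω _ μ _ G hG => h θ 0 hθ δ hδ Ω μ G hG⟩
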